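/- Consider the dynamic panel model $y_{i,t}=\sum_{l=1}^{L}\alpha_l y_{i,t-l}+x_{i,t}'\beta+\eta_i+\varepsilon_{i,t}$, $i=1,\dots,N$, $t=1,\dots,T$, with initial observations $y_{i,0},\dots,y_{i,1-L}$, and write $z_{i,t}=(y_{i,t-1},\dots,y_{i,t-L},x_{i,t}')'\in\mathbb R^{p}$, $\alpha=(\alpha_1,\dots,\alpha_L,\beta')'\in\mathbb R^p$, $\eta=(\eta_1,\dots,\eta_N)'$, $\gamma=(\alpha',\eta')'$, so that in stacked form $y=\Pi\gamma+\varepsilon$ with $\Pi=(Z,D)$, where $Z$ has rows $z_{i,t}'$ and $D=I_N\otimes\iota$ with $\iota\in\mathbb R^T$ the vector of ones. The quantities $T\ge 1$, $L$, $p$, $1\le s_1\le p$ and $E>0$ may depend on $N$ arbitrarily, and $\nu\in(0,1)$ is fixed. Let $$\mathcal F(s_1,\nu,E)=\Big\{\alpha\in\mathbb R^p:\#\{j:\alpha_j\ne0\}\le s_1\Big\}\times\Big\{\eta\in\mathbb R^N:\sum_{i=1}^N|\eta_i|^\nu\le E\Big\}.$$ For $\lambda_N=\sqrt{4MNT(\log(p\vee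 N))^3}$ with $M>0$, let $\hat\gamma=(\hat\alpha',\hat\eta')'$ be any minimiser of $$\|y-\Pi\gamma\|^2+2\lambda_N\|\alpha\|_1+2\tfrac{\lambda_N}{\sqrt N}\|\eta\|_1 .$$ Assume, with constants $C,K,\kappa_0>0$ that do not depend on $N$: 1. the vectors $(y_{i,0},\dots,y_{i,1-L},x_{i,1}',\dots,x_{i,T}',\varepsilon_{i,1},\dots,\varepsilon_{i,T})$, $i=1,\dots,N$, are independent, and $\mathbb E[\varepsilon_{i,t}\mid y_{i,t-1},\dots,y_{i,1-L},x_{i,t},\dots,x_{i,1}]=0$ for all $i,t$; 2. with $\Psi_Z=\frac1{NT}\sum_{i=1}^N\sum_{t=1}^T\mathbb E[z_{i,t}z_{i,t}']$, $$\kappa_2^2:=1\wedge\min_{R\subseteq\{1,\dots,p\},\,|R|\le s_1}\ \min_{\delta\in\mathbb R^p\setminus\{0\},\ \|\delta_{R^c}\|_1\le4\|\delta_R\|_1}\frac{\delta'\Psi_Z\delta}{\delta_R'\delta_R}\ \ge\ \kappa_0;$$ 3. $\mathbb P(|\varepsilon_{i,t}|\ge\epsilon)\le\frac12Ke^{-C\epsilon^2}$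 and $\mathbb P(|z_{i,t,l}|\ge\epsilon)\le\frac12Ke^{-C\epsilon^2}$ for all $\epsilon\ge0$ and all $i,t,l$. Then there is $M_0>0$, depending only on $C$ and $K$, such that for every $M\ge M_0$ the following holds. If $$\frac{(\log(p\vee N))^3\big[s_1+E\big(\frac{\lambda_N}{\sqrt N\,T}\big)^{-\nu}\big]^2}{N}\longrightarrow0\qquad(N\to\infty),$$ then $$\tfrac1{NT}\|\Pi(\hat\gamma-\gamma)\|^2=O_p\Big(s_1\big(\tfrac{\lambda_N}{NT}\big)^2\Big)+O_p\Big(\tfrac{\lambda_N}{\sqrt N\,NT}E\big(\tfrac{\lambda_N}{\sqrt N\,T}\big)^{1-\nu}\Big),$$ $$\|\hat\alpha-\alpha\|_1=O_p\Big(s_1\tfrac{\lambda_N}{NT}\Big)+O_p\Big(\tfrac1{\sqrt N}E\big(\tfrac{\lambda_N}{\sqrt N\,T}\big)^{1-\nu}\Big),$$ $$\|\hat\eta-\eta\|_1=O_p\Big(s_1\tfrac{\lambda_N}{\sqrt N\,T}\Big)+O_p\Big(E\big(\tfrac{\lambda_N}{\sqrt N\,T}\big)^{1-\nu}\Big),$$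 uniformly over $\gamma\in\mathcal F(s_1,\nu,E)$: for every $\delta>0$ there are $B>0$ and $N_0$ such that, for all $N\ge N_0$ and all models satisfying 1.–3. (with these $C,K,\kappa_0$) whose true parameter lies in $\mathcal F(s_1,\nu,E)$, each of the three errors exceeds $B$ times the sum of its two rates with probability at most $\delta$. -/

import Mathlib

open MeasureTheory ProbabilityTheory Filter Topology

noncomputable section

/-- A dynamic panel data model with fixed effects on the sample space `Ω`: `N` individuals,
`T` periods, `L` lags of the left hand side variable and `q` further covariates.
Calendar time is `ℤ`; `t : Fin T` stands for the period `t + 1 ∈ {1, …, T}` and `l : Fin L` for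
the lag `l + 1 ∈ {1, …, L}`.  The initial observations are `y i 0, y i (-1), …, y i (1 - L)`;
values of `y i` outside `{1 - L, …, T}` play no role. -/
structure DynamicPanel (Ω : Type*) [MeasurableSpace Ω] (N T L q : ℕ) where
  /-- left hand side variable -/
  y : Fin N → ℤ → Ω → ℝ
  /-- covariates other than the lags of `y` -/
  x : Fin N → Fin T → Fin q → Ω → ℝ
  /-- idiosyncratic error terms -/
  ε : Fin N → Fin T → Ω → ℝ
  /-- true coefficients of the `L` lags (left summand) and of the `q` covariates (right) -/
  α : Fin L ⊕ Fin q → ℝ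
  /-- true fixed effects -/
  η : Fin N → ℝ
  measurable_y : ∀ i τ, Measurable (y i τ)
  measurable_x : ∀ i t k, Measurable (x i t k)
  measurable_ε : ∀ i t, Measurable (ε i t)
  /-- `y_{i,t} = ∑_l α_l y_{i,t-l} + x_{i,t}' β + η_i + ε_{i,t}` for `t = 1, …, T` -/
  model_eq : ∀ (i : Fin N) (t : Fin T) (ω : Ω),
    y i ((t : ℤ) + 1) ω =
      (∑ l : Fin L, α (Sum.inl l) * y i (((t : ℤ) + 1) - ((l : ℤ) + 1)) ω)
        + (∑ k : Fin q, x i t k ω * α (Sum.inr k)) + η i + ε i t ω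

/-- The restricted eigenvalue
`1 ∧ min_{|R| ≤ r} min_{δ ≠ 0, ‖δ_{Rᶜ}‖₁ ≤ 4 ‖δ_R‖₁} δ' A δ / (δ_R' δ_R)`. -/
def restrictedEigenvalueSq {ι : Type*} [Fintype ι] [DecidableEq ι] (A : Matrix ι ι ℝ) (r : ℕ) : ℝ :=
  min 1 (sInf {v : ℝ | ∃ (R : Finset ι) (δ : ι → ℝ), R.card ≤ r ∧ δ ≠ 0 ∧
    ∑ j ∈ Rᶜ, |δ j| ≤ 4 * ∑ j ∈ R, |δ j| ∧ v = (δ ⬝ᵥ A.mulVec δ) / ∑ j ∈ R, δ j ^ 2})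

/-- The class `F(s, ν, E)`: `‖α‖₀ ≤ s` and `∑ |η_i|^ν ≤ E`. -/
def sparseClass {ι : Type*} [Fintype ι] {N : ℕ} (s : ℕ) (ν E : ℝ) :
    Set ((ι → ℝ) × (Fin N → ℝ)) :=
  {a | {j | a j ≠ 0}.ncard ≤ s} ×ˢ {h | ∑ i, |h i| ^ ν ≤ E}

/-- The penalty level `λ_N = √(4 M N T (log (p ∨ N))³)`. -/
def penaltyLevel (M : ℝ) (N T p : ℕ) : ℝ :=
  Real.sqrt (4 * M * N * T * Real.log (max p N : ℕ) ^ 3)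

/-- The threshold `λ_N / (√N T)`. -/
def thresholdLevel (M : ℝ) (N T p : ℕ) : ℝ :=
  penaltyLevel M N T p / (Real.sqrt N * T)

namespace DynamicPanel

variable {Ω : Type*} [MeasurableSpace Ω] {N T L q : ℕ}

/-- The regressors `z_{i,t} = (y_{i,t-1}, …, y_{i,t-L}, x_{i,t}')'`. -/
def z (P : DynamicPanel Ω N T L q) (i : Fin N) (t : Fin T) (j : Fin L ⊕ Fin q) (ω : Ω) : ℝ :=
  Sum.elim (fun l : Fin L => P.y i (((t : ℤ) + 1) - ((l : ℤ) + 1)) ω)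
    (fun k : Fin q => P.x i t k ω) j

/-- The `NT × p` matrix `Z` with rows `z_{i,t}'`. -/
def Z (P : DynamicPanel Ω N T L q) (ω : Ω) : Matrix (Fin N × Fin T) (Fin L ⊕ Fin q) ℝ :=
  Matrix.of fun r j => P.z r.1 r.2 j ω

/-- The `NT × (p + N)` design matrix `(Z, D)`, with `D = I_N ⊗ ι` the matrix of individual
dummies. -/
def design (P : DynamicPanel Ω N T L q) (ω : Ω) :
    Matrix (Fin N × Fin T) ((Fin L ⊕ Fin q) ⊕ Fin N) ℝ :=
  Matrix.fromCols (P.Z ω) (Matrix.of fun r j => if r.1 = j then 1 else 0)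

/-- The panel Lasso objective
`‖y - Z a - D h‖² + 2 λ ‖a‖₁ + 2 (λ / √N) ‖h‖₁`. -/
def lassoObjective (P : DynamicPanel Ω N T L q) (lam : ℝ) (ω : Ω)
    (g : (Fin L ⊕ Fin q → ℝ) × (Fin N → ℝ)) : ℝ :=
  ∑ r : Fin N × Fin T,
      (P.y r.1 ((r.2 : ℤ) + 1) ω - (P.design ω).mulVec (Sum.elim g.1 g.2) r) ^ 2
    + 2 * lam * ∑ j, |g.1 j| + 2 * (lam / Real.sqrt N) * ∑ i, |g.2 i|

/-- `(a ω, h ω)` is, almost surely, a minimiser of the panel Lasso objective. -/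
def IsPanelLasso (P : DynamicPanel Ω N T L q) (μ : Measure Ω) (lam : ℝ)
    (a : Ω → Fin L ⊕ Fin q → ℝ) (h : Ω → Fin N → ℝ) : Prop :=
  ∀ᵐ ω ∂μ, ∀ g, P.lassoObjective lam ω (a ω, h ω) ≤ P.lassoObjective lam ω g

/-- The prediction error `(NT)⁻¹ ‖Z (a - α) + D (h - η)‖²`. -/
def predictionError (P : DynamicPanel Ω N T L q) (ω : Ω)
    (a : Fin L ⊕ Fin q → ℝ) (h : Fin N → ℝ) : ℝ :=
  1 / ((N : ℝ) * T) *
    ∑ r : Fin N × Fin T, (P.design ω).mulVec (Sum.elim (a - P.α) (h - P.η)) r ^ 2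

/-- The `σ`-algebra generated by `y_{i,t-1}, …, y_{i,1-L}, x_{i,t}, …, x_{i,1}`, where the period
is `t + 1` for `t : Fin T`. -/
@[reducible] def past (P : DynamicPanel Ω N T L q) (i : Fin N) (t : Fin T) : MeasurableSpace Ω :=
  (⨆ τ ∈ Set.Icc (1 - (L : ℤ)) (t : ℤ), MeasurableSpace.comap (P.y i τ) inferInstance) ⊔
    (⨆ s ∈ Set.Iic t, ⨆ k : Fin q, MeasurableSpace.comap (P.x i s k) inferInstance)

/-- Independence across individuals of (initial observations, covariates, errors), and
`E[ε_{i,t} | y_{i,t-1}, …, y_{i,1-L}, x_{i,t}, …, x_{i,1}] = 0`. -/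
structure IndependentPredetermined (P : DynamicPanel Ω N T L q) (μ : Measure Ω) : Prop where
  indep : iIndepFun
    (fun (i : Fin N) (ω : Ω) =>
      ((fun l : Fin L => P.y i (-(l : ℤ)) ω,
        fun (t : Fin T) (k : Fin q) => P.x i t k ω,
        fun t : Fin T => P.ε i t ω) : (Fin L → ℝ) × (Fin T → Fin q → ℝ) × (Fin T → ℝ))) μ
  condExp_eq_zero : ∀ i t, μ[P.ε i t | P.past i t] =ᵐ[μ] 0

/-- The population matrix `Ψ_Z = (NT)⁻¹ ∑_i ∑_t E[z_{i,t} z_{i,t}']`. -/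
def populationGram (P : DynamicPanel Ω N T L q) (μ : Measure Ω) :
    Matrix (Fin L ⊕ Fin q) (Fin L ⊕ Fin q) ℝ :=
  Matrix.of fun j k =>
    1 / ((N : ℝ) * T) * ∑ i : Fin N, ∑ t : Fin T, ∫ ω, P.z i t j ω * P.z i t k ω ∂μ

/-- Uniform subgaussianity of the errors and of the regressors with constants `C` and `K`. -/
structure UniformlySubgaussian (P : DynamicPanel Ω N T L q) (μ : Measure Ω) (C K : ℝ) : Prop where
  error_tail : ∀ i t, ∀ e : ℝ, 0 ≤ e →
    μ.real {ω | e ≤ |P.ε i t ω|} ≤ 1 / 2 * K * Real.exp (-C * e ^ 2)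
  regressor_tail : ∀ i t j, ∀ e : ℝ, 0 ≤ e →
    μ.real {ω | e ≤ |P.z i t j ω|} ≤ 1 / 2 * K * Real.exp (-C * e ^ 2)

end DynamicPanel

end

/-! The argument joins a deterministic oracle inequality to a moment bound that controls the random
inputs.

Deterministic side: rescale the fixed effects by `√N`, so that both penalties have the common level
`l = λ/(NT)` and the dummy block of the Gram matrix is the identity. Only the coefficients of `z`
then need the restricted eigenvalue condition. If the penalty dominates the noise and both the Gram
matrix of `z` and its cross terms with the dummies are within `τ` of their targets (`populationGram`
and zero), the Lasso errors are governed by `S l + e`. Here `S = s + E x^(-ν)` bounds the sparsity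
of `α` and the number of effects above the threshold `x`, and `e` is the scaled mass of the effects
below it (`lasso_oracle_inequality`, `lasso_error_bounds`). The condition required is `S τ` small
relative to `κ₀`.

Random side: in the lexicographic order on `(i, t)` each `z ε` is orthogonal to powers of earlier
partial sums, by independence across individuals and the conditional mean zero given an individual's
own past. A Burkholder-type inequality (`integral_sum_pow_le`) bounds the `2m`-th moment of a sum of
`n` such terms by `(16 m n b²)^m`. Subgaussian tails allow `b` of order `m`, and `m` is taken of
order `log (p ∨ N)`. Hence squared sums are of order `n log³`, which is the cube in `λ_N`, with
failure probability small enough for a union over all coordinates. The same bound over independent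
individuals gives `τ² ≍ log³ / N`, and the rate hypothesis then says exactly that `S τ → 0`. -/

/-! ### Elementary inequalities for even powers. -/

lemma two_mul_exp_sub_le {w : ℝ} (hw : 0 ≤ w) :
    2 * Real.exp w - 1 - 2 * w ≤ Real.exp (2 * w ^ 2) := by
  rcases le_total w 1 with h | h
  · have h1 := (abs_le.1 (Real.abs_exp_sub_one_sub_id_le (by rwa [abs_of_nonneg hw]))).2
    have h2 := Real.add_one_le_exp (2 * w ^ 2)
    linarith
  · have h1 : 2 * Real.exp w ≤ Real.exp (2 * w ^ 2) := by
      calc 2 * Real.exp w ≤ Real.exp 1 * Real.exp w := by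
            gcongr
            have := Real.add_one_le_exp 1
            linarith
        _ = Real.exp (1 + w) := (Real.exp_add _ _).symm
        _ ≤ _ := Real.exp_le_exp.2 (by nlinarith)
    linarith

lemma two_mul_one_add_pow_sub_le {m : ℕ} {r : ℝ} (hr : 0 ≤ r) (h : 16 * m * r ^ 2 ≤ 1) :
    2 * (1 + r) ^ (2 * m) - 1 - 4 * m * r ≤ (1 + 16 * m * r ^ 2) ^ m := by
  have h1 : (1 + r) ^ (2 * m) ≤ Real.exp (2 * m * r) := by
    calc (1 + r) ^ (2 * m) ≤ Real.exp r ^ (2 * m) := by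
          gcongr
          linarith [Real.add_one_le_exp r]
      _ = _ := by rw [← Real.exp_nat_mul]; push_cast; ring_nf
  have h2 : Real.exp (2 * (2 * m * r) ^ 2) ≤ (1 + 16 * m * r ^ 2) ^ m := by
    calc Real.exp (2 * (2 * m * r) ^ 2) = Real.exp (8 * m * r ^ 2) ^ m := by
          rw [← Real.exp_nat_mul]; ring_nf
      _ ≤ _ := by
          have h0 : (0 : ℝ) ≤ 8 * m * r ^ 2 := by positivity
          have := (abs_le.1 (Real.abs_exp_sub_one_sub_id_le (x := 8 * m * r ^ 2)
            (by rw [abs_of_nonneg h0]; linarith))).2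
          gcongr
          nlinarith
  have h3 := two_mul_exp_sub_le (w := 2 * m * r) (by positivity)
  linarith

/-- Numerical core of the moment induction: `a^(2m)` plus twice the part of `(a + b)^(2m)` of order
at least two in `b` costs only an additive `16 m b²` in the variance proxy `a²`. After scaling by
`a`, it follows by passing through `exp (8 m² r²)` with `r = b / a`. -/
lemma two_mul_add_pow_sub_le {m : ℕ} (hm : 1 ≤ m) {a b : ℝ} (ha : 0 < a) (hb : 0 ≤ b)
    (h : 16 * m * b ^ 2 ≤ a ^ 2) :
    a ^ (2 * m) + 2 * ((a + b) ^ (2 * m) - a ^ (2 * m) - (2 * m : ℕ) * a ^ (2 * m - 1) * b)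
      ≤ (a ^ 2 + 16 * m * b ^ 2) ^ m := by
  have hr : 0 ≤ b / a := by positivity
  have key := two_mul_one_add_pow_sub_le (m := m) hr (by
    rw [div_pow, mul_div_assoc', div_le_one (by positivity)]; exact h)
  have e1 : (a + b) ^ (2 * m) = a ^ (2 * m) * (1 + b / a) ^ (2 * m) := by
    rw [← mul_pow]; congr 1; field_simp
  have e2 : (a ^ 2 + 16 * m * b ^ 2) ^ m = a ^ (2 * m) * (1 + 16 * m * (b / a) ^ 2) ^ m := by
    rw [pow_mul, ← mul_pow]; congr 1; field_simp
  have e3 : a ^ (2 * m - 1) * b = a ^ (2 * m) * (b / a) := by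
    obtain ⟨k, rfl⟩ : ∃ k, m = k + 1 := ⟨m - 1, by omega⟩
    rw [show 2 * (k + 1) - 1 = 2 * k + 1 by omega, show 2 * (k + 1) = 2 * k + 1 + 1 by ring,
      pow_succ a (2 * k + 1)]
    field_simp
  have := mul_le_mul_of_nonneg_left key (pow_pos ha (2 * m)).le
  rw [mul_assoc, e1, e2, e3]
  push_cast
  linarith

lemma pow_mul_pow_le_add {u v : ℝ} (hu : 0 ≤ u) (hv : 0 ≤ v) (i j : ℕ) :
    u ^ i * v ^ j ≤ u ^ (i + j) + v ^ (i + j) := by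
  rcases le_total u v with h | h
  · calc u ^ i * v ^ j ≤ v ^ i * v ^ j := by gcongr
      _ ≤ _ := by rw [← pow_add]; linarith [pow_nonneg hu (i + j)]
  · calc u ^ i * v ^ j ≤ u ^ i * u ^ j := by gcongr
      _ ≤ _ := by rw [← pow_add]; linarith [pow_nonneg hv (i + j)]

/-- The linear term in `x` is kept exact because its mean will vanish. Each monomial of degree at
least two in `x` is bounded by its value at `(a, b)` times `(s/a)^(n+2) + (x/b)^(n+2)`, and these
values resum to the second-order remainder of `(a + b)^(n+2)`. Evenness removes the absolute values.
-/
lemma add_pow_le_of_even {n : ℕ} (hn : Even n) (s x : ℝ) {a b : ℝ} (ha : 0 < a) (hb : 0 < b) :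
    (s + x) ^ (n + 2) ≤ s ^ (n + 2) + (n + 2 : ℕ) * (s ^ (n + 1) * x)
      + ((a + b) ^ (n + 2) - a ^ (n + 2) - (n + 2 : ℕ) * a ^ (n + 1) * b)
        * ((s / a) ^ (n + 2) + (x / b) ^ (n + 2)) := by
  have hn2 : Even (n + 2) := hn.add even_two
  have expand : ∀ s x : ℝ, (s + x) ^ (n + 2) = ∑ k ∈ Finset.range (n + 1),
      x ^ (k + 2) * s ^ (n - k) * ((n + 2).choose (k + 2)) + (n + 2 : ℕ) * (s ^ (n + 1) * x)
        + s ^ (n + 2) := by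
    intro s x
    rw [add_comm s x, add_pow, Finset.sum_range_succ', Finset.sum_range_succ']
    congr 1
    · congr 1
      · refine Finset.sum_congr rfl fun k _ => ?_
        rw [show n + 2 - (k + 1 + 1) = n - k by omega]
      · simp; ring
    · simp
  rw [expand s x, expand a b]
  have : ∑ k ∈ Finset.range (n + 1), x ^ (k + 2) * s ^ (n - k) * ((n + 2).choose (k + 2))
      ≤ (∑ k ∈ Finset.range (n + 1), b ^ (k + 2) * a ^ (n - k) * ((n + 2).choose (k + 2)))
        * ((s / a) ^ (n + 2) + (x / b) ^ (n + 2)) := by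
    rw [Finset.sum_mul]
    refine Finset.sum_le_sum fun k hk => ?_
    have hk' : k ≤ n := by have := Finset.mem_range.1 hk; omega
    have h1 := pow_mul_pow_le_add (abs_nonneg (x / b)) (abs_nonneg (s / a)) (k + 2) (n - k)
    rw [show k + 2 + (n - k) = n + 2 by omega, hn2.pow_abs, hn2.pow_abs] at h1
    have h2 : x ^ (k + 2) * s ^ (n - k)
        ≤ b ^ (k + 2) * a ^ (n - k) * (|x / b| ^ (k + 2) * |s / a| ^ (n - k)) := by
      refine (le_abs_self _).trans (le_of_eq ?_)
      rw [abs_mul, abs_pow, abs_pow, abs_div, abs_div, abs_of_pos ha, abs_of_pos hb, div_pow,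
        div_pow]
      field_simp
    calc x ^ (k + 2) * s ^ (n - k) * ((n + 2).choose (k + 2))
        ≤ b ^ (k + 2) * a ^ (n - k) * ((x / b) ^ (n + 2) + (s / a) ^ (n + 2))
          * ((n + 2).choose (k + 2)) := by
          refine mul_le_mul_of_nonneg_right (h2.trans ?_) (Nat.cast_nonneg _)
          exact mul_le_mul_of_nonneg_left h1 (by positivity)
      _ = _ := by ring
  linarith

/-! ### Closure properties of variables with all moments. -/

/-- Random variables with finite absolute moments of all orders. -/
structure HasAllMoments {Ω : Type*} [MeasurableSpace Ω] (X : Ω → ℝ) (μ : Measure Ω) : Prop where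
  aesm : AEStronglyMeasurable X μ
  integrable_abs_pow : ∀ n : ℕ, Integrable (fun ω => |X ω| ^ n) μ

namespace HasAllMoments

variable {Ω : Type*} [MeasurableSpace Ω] {μ : Measure Ω} {X Y : Ω → ℝ}

lemma integrable_pow (hX : HasAllMoments X μ) (n : ℕ) : Integrable (fun ω => X ω ^ n) μ :=
  (hX.integrable_abs_pow n).mono' (hX.aesm.pow n) (ae_of_all _ fun ω => by simp)

lemma integrable (hX : HasAllMoments X μ) : Integrable X μ := by
  simpa using hX.integrable_pow 1

lemma of_even (hX : AEStronglyMeasurable X μ)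
    [IsFiniteMeasure μ] (h : ∀ n : ℕ, Integrable (fun ω => X ω ^ (2 * n)) μ) :
    HasAllMoments X μ := by
  refine ⟨hX, fun n => ((integrable_const (1 : ℝ)).add (h n)).mono' (hX.norm.pow n)
    (ae_of_all _ fun ω => ?_)⟩
  have := two_mul_le_add_sq (|X ω| ^ n) 1
  have e : (|X ω| ^ n) ^ 2 = X ω ^ (2 * n) := by
    rw [← pow_mul, mul_comm, pow_mul, sq_abs, pow_mul]
  simp only [Real.norm_eq_abs, abs_pow, abs_abs, Pi.add_apply]
  have h0 : 0 ≤ |X ω| ^ n := by positivity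
  nlinarith

lemma const [IsFiniteMeasure μ] (c : ℝ) : HasAllMoments (fun _ : Ω => c) μ :=
  ⟨aestronglyMeasurable_const, fun _ => integrable_const _⟩

lemma mul (hX : HasAllMoments X μ) (hY : HasAllMoments Y μ) :
    HasAllMoments (fun ω => X ω * Y ω) μ := by
  refine ⟨hX.aesm.mul hY.aesm, fun n =>
    ((hX.integrable_abs_pow (n + n)).add (hY.integrable_abs_pow (n + n))).mono'
      ((hX.aesm.mul hY.aesm).norm.pow n) (ae_of_all _ fun ω => ?_)⟩
  simp only [Real.norm_eq_abs, abs_pow, abs_abs, Pi.add_apply, abs_mul, mul_pow]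
  exact pow_mul_pow_le_add (abs_nonneg _) (abs_nonneg _) n n

lemma add (hX : HasAllMoments X μ) (hY : HasAllMoments Y μ) :
    HasAllMoments (fun ω => X ω + Y ω) μ := by
  refine ⟨hX.aesm.add hY.aesm, fun n =>
    (((hX.integrable_abs_pow n).add (hY.integrable_abs_pow n)).const_mul (2 ^ n)).mono'
      ((hX.aesm.add hY.aesm).norm.pow n) (ae_of_all _ fun ω => ?_)⟩
  simp only [Real.norm_eq_abs, abs_pow, abs_abs, Pi.add_apply]
  have hx := abs_nonneg (X ω)
  have hy := abs_nonneg (Y ω)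
  have h1 := abs_add_le (X ω) (Y ω)
  rcases le_total |X ω| |Y ω| with h | h
  · calc |X ω + Y ω| ^ n ≤ (2 * |Y ω|) ^ n := by gcongr; linarith
      _ ≤ _ := by rw [mul_pow]; gcongr; linarith [pow_nonneg hx n]
  · calc |X ω + Y ω| ^ n ≤ (2 * |X ω|) ^ n := by gcongr; linarith
      _ ≤ _ := by rw [mul_pow]; gcongr; linarith [pow_nonneg hy n]

lemma sum [IsFiniteMeasure μ] {ι : Type*} {X : ι → Ω → ℝ} (s : Finset ι)
    (hX : ∀ i ∈ s, HasAllMoments (X i) μ) :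
    HasAllMoments (fun ω => ∑ i ∈ s, X i ω) μ := by
  classical
  induction s using Finset.induction_on with
  | empty => simpa using const (μ := μ) 0
  | insert i s hi ih =>
    simp only [Finset.sum_insert hi]
    exact (hX i (by simp)).add (ih fun j hj => hX j (by simp [hj]))

lemma pow [IsFiniteMeasure μ] (hX : HasAllMoments X μ) (n : ℕ) :
    HasAllMoments (fun ω => X ω ^ n) μ :=
  ⟨hX.aesm.pow n, fun k => by simpa [abs_pow, ← pow_mul] using hX.integrable_abs_pow (n * k)⟩

lemma const_mul [IsFiniteMeasure μ] (hX : HasAllMoments X μ) (c : ℝ) :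
    HasAllMoments (fun ω => c * X ω) μ := (const c).mul hX

end HasAllMoments

/-! ### Moment inequality for orthogonal increments and the resulting tail bound. -/

section Moments

variable {Ω : Type*} [MeasurableSpace Ω] {μ : Measure Ω} [IsProbabilityMeasure μ]

/-- Induction step for the moment inequality: integrating `add_pow_le_of_even` kills the linear
term, and the remainder contributes at most `2 G`. -/
lemma integral_add_pow_le {S X : Ω → ℝ} (hS : HasAllMoments S μ) (hX : HasAllMoments X μ)
    {m k : ℕ} (hm : 1 ≤ m) (hk : 1 ≤ k) {b : ℝ} (hb : 0 < b)
    (hSk : ∫ ω, S ω ^ (2 * m) ∂μ ≤ (16 * m * k * b ^ 2) ^ m)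
    (hXb : ∫ ω, X ω ^ (2 * m) ∂μ ≤ b ^ (2 * m))
    (h0 : ∫ ω, S ω ^ (2 * m - 1) * X ω ∂μ = 0) :
    ∫ ω, (S ω + X ω) ^ (2 * m) ∂μ ≤ (16 * m * (k + 1 : ℕ) * b ^ 2) ^ m := by
  obtain ⟨n, rfl⟩ : ∃ n, m = n + 1 := ⟨m - 1, by omega⟩
  set m := n + 1 with hmdef
  have hm0 : (1 : ℝ) ≤ m := by exact_mod_cast hm
  have hk0 : (1 : ℝ) ≤ k := by exact_mod_cast hk
  -- `a` and `b` are the assumed bounds on the `L^{2m}` norms of `S` and `X`; with them both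
  -- normalised moments are at most one.
  set a := Real.sqrt (16 * m * k) * b with hadef
  have ha : 0 < a := by positivity
  have ha2 : a ^ 2 = 16 * m * k * b ^ 2 := by
    rw [hadef, mul_pow, Real.sq_sqrt (by positivity)]
  rw [← ha2, ← pow_mul] at hSk
  set G := (a + b) ^ (2 * m) - a ^ (2 * m) - (2 * m : ℕ) * a ^ (2 * m - 1) * b with hG
  have hpt : ∀ ω, (S ω + X ω) ^ (2 * m) ≤ S ω ^ (2 * m)
      + (2 * m : ℕ) * (S ω ^ (2 * m - 1) * X ω)
      + (G * (a ^ (2 * m))⁻¹ * S ω ^ (2 * m) + G * (b ^ (2 * m))⁻¹ * X ω ^ (2 * m)) := by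
    intro ω
    have := add_pow_le_of_even (n := 2 * n) (by simp) (S ω) (X ω) ha hb
    rw [div_pow, div_pow] at this
    refine this.trans (le_of_eq ?_)
    rw [hG, hmdef, show 2 * (n + 1) - 1 = 2 * n + 1 by omega, show 2 * (n + 1) = 2 * n + 2 by ring]
    ring
  have i1 := hS.integrable_pow (2 * m)
  have i2 := hX.integrable_pow (2 * m)
  have i3 : Integrable (fun ω => S ω ^ (2 * m - 1) * X ω) μ :=
    ((hS.pow (2 * m - 1)).mul hX).integrable
  have j1 : Integrable (fun ω => (2 * m : ℕ) * (S ω ^ (2 * m - 1) * X ω)) μ := i3.const_mul _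
  have j2 : Integrable (fun ω => S ω ^ (2 * m)
      + (2 * m : ℕ) * (S ω ^ (2 * m - 1) * X ω)) μ := i1.add j1
  have j3 : Integrable (fun ω => G * (a ^ (2 * m))⁻¹ * S ω ^ (2 * m)) μ := i1.const_mul _
  have j4 : Integrable (fun ω => G * (b ^ (2 * m))⁻¹ * X ω ^ (2 * m)) μ := i2.const_mul _
  have j5 : Integrable (fun ω => G * (a ^ (2 * m))⁻¹ * S ω ^ (2 * m)
      + G * (b ^ (2 * m))⁻¹ * X ω ^ (2 * m)) μ := j3.add j4
  have hG0 : 0 ≤ G := by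
    have hbern := one_add_mul_le_pow (a := b / a) (by
      have : 0 ≤ b / a := by positivity
      linarith) (2 * m)
    have e1 : (a + b) ^ (2 * m) = a ^ (2 * m) * (1 + b / a) ^ (2 * m) := by
      rw [← mul_pow]; congr 1; field_simp
    have e3 : a ^ (2 * m - 1) * b = a ^ (2 * m) * (b / a) := by
      rw [show 2 * m - 1 = 2 * n + 1 by omega, show 2 * m = 2 * n + 1 + 1 by omega,
        pow_succ a (2 * n + 1)]
      field_simp
    rw [hG, mul_assoc, e1, e3]
    have := mul_le_mul_of_nonneg_left hbern (pow_pos ha (2 * m)).le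
    nlinarith
  calc ∫ ω, (S ω + X ω) ^ (2 * m) ∂μ
      ≤ ∫ ω, (S ω ^ (2 * m) + (2 * m : ℕ) * (S ω ^ (2 * m - 1) * X ω)
        + (G * (a ^ (2 * m))⁻¹ * S ω ^ (2 * m) + G * (b ^ (2 * m))⁻¹ * X ω ^ (2 * m))) ∂μ :=
        integral_mono ((hS.add hX).integrable_pow _)
          (j2.add j5) hpt
    _ = ∫ ω, S ω ^ (2 * m) ∂μ + G * (a ^ (2 * m))⁻¹ * ∫ ω, S ω ^ (2 * m) ∂μ
        + G * (b ^ (2 * m))⁻¹ * ∫ ω, X ω ^ (2 * m) ∂μ := by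
        rw [integral_add j2 j5, integral_add i1 j1, integral_add j3 j4,
          integral_const_mul, integral_const_mul, integral_const_mul, h0]
        ring
    _ ≤ a ^ (2 * m) + G * (a ^ (2 * m))⁻¹ * a ^ (2 * m)
        + G * (b ^ (2 * m))⁻¹ * b ^ (2 * m) := by gcongr
    _ = a ^ (2 * m) + 2 * G := by field_simp; ring
    _ ≤ (a ^ 2 + 16 * m * b ^ 2) ^ m := by
        refine two_mul_add_pow_sub_le hm ha hb.le ?_
        rw [ha2]
        have : 16 * (m : ℝ) * 1 * b ^ 2 ≤ 16 * m * k * b ^ 2 := by gcongr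
        linarith
    _ = _ := by rw [ha2]; push_cast; ring

/-- Moment inequality for sums whose increments are orthogonal to powers of earlier partial sums. -/
lemma integral_sum_pow_le {ι : Type*} [LinearOrder ι] {X : ι → Ω → ℝ}
    (hX : ∀ r, HasAllMoments (X r) μ) {m : ℕ} (hm : 1 ≤ m) {b : ℝ} (hb : 0 < b)
    (hXb : ∀ r, ∫ ω, X r ω ^ (2 * m) ∂μ ≤ b ^ (2 * m))
    (h0 : ∀ r (s : Finset ι), (∀ r' ∈ s, r' < r) →
      ∫ ω, (∑ r' ∈ s, X r' ω) ^ (2 * m - 1) * X r ω ∂μ = 0) (s : Finset ι) :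
    ∫ ω, (∑ r ∈ s, X r ω) ^ (2 * m) ∂μ ≤ (16 * m * s.card * b ^ 2) ^ m := by
  induction s using Finset.induction_on_max with
  | empty => simp [show m ≠ 0 by omega]
  | insert r s hs ih =>
    have hr : r ∉ s := fun h => lt_irrefl _ (hs r h)
    simp only [Finset.sum_insert hr, Finset.card_insert_of_notMem hr]
    simp only [add_comm (X r _)]
    -- The first increment is separate: the numerical inequality requires `16 m b² ≤ a²`, that is,
    -- at least one earlier term.
    rcases s.eq_empty_or_nonempty with rfl | hne
    · simp only [Finset.sum_empty, zero_add, Finset.card_empty, Nat.cast_one, mul_one]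
      refine (hXb r).trans ?_
      rw [pow_mul]
      gcongr
      have : (1 : ℝ) ≤ m := by exact_mod_cast hm
      nlinarith [sq_nonneg b]
    · exact integral_add_pow_le (HasAllMoments.sum s fun i _ => hX i) (hX r) hm
        (Finset.card_pos.2 hne) hb ih (hXb r) (h0 r s hs)

/-- Markov's inequality for the `2m`-th power gives `9^(-m)`, and `e² < 9`. -/
lemma measure_sq_gt_le {S : Ω → ℝ} (hS : HasAllMoments S μ) {m : ℕ} {A : ℝ}
    (hA : 0 < A) (h : ∫ ω, S ω ^ (2 * m) ∂μ ≤ A ^ m) :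
    μ.real {ω | 9 * A < S ω ^ 2} ≤ Real.exp (-(2 * m)) := by
  have hmk := mul_meas_ge_le_integral_of_nonneg (μ := μ) (f := fun ω => S ω ^ (2 * m))
    (ae_of_all _ fun ω => by simp only [Pi.zero_apply]; rw [pow_mul]; positivity)
    (hS.integrable_pow _) ((9 * A) ^ m)
  have hsub : μ.real {ω | 9 * A < S ω ^ 2} ≤ μ.real {ω | (9 * A) ^ m ≤ S ω ^ (2 * m)} := by
    refine measureReal_mono fun ω hω => ?_
    simp only [Set.mem_ofPred_eq] at hω ⊢
    rw [pow_mul]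
    gcongr
  have h9 : μ.real {ω | (9 * A) ^ m ≤ S ω ^ (2 * m)} ≤ (9 ^ m : ℝ)⁻¹ := by
    have h1 := hmk.trans h
    rw [mul_pow, mul_comm ((9 : ℝ) ^ m), mul_assoc, mul_comm (A ^ m) (9 ^ m), ← mul_pow] at h1
    have h2 := le_of_mul_le_mul_left (h1.trans_eq (mul_one _).symm) (pow_pos hA m)
    rw [← one_div, le_div_iff₀' (by positivity)]
    exact h2
  refine (hsub.trans h9).trans ?_
  rw [Real.exp_neg]
  have : Real.exp (2 * m) ≤ 9 ^ m := by
    rw [show (2 * (m : ℝ)) = m * 2 by ring, Real.exp_nat_mul]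
    gcongr
    rw [show (2 : ℝ) = (2 : ℕ) * 1 by norm_num, Real.exp_nat_mul]
    have := Real.exp_one_lt_d9
    have h0 := Real.exp_pos 1
    nlinarith
  gcongr

end Moments

/-! ### Moments of subgaussian variables, products, averages and centred variables. -/

section Tails

variable {Ω : Type*} [MeasurableSpace Ω] {μ : Measure Ω} [IsProbabilityMeasure μ]

/-- Layer-cake formula. With half of the exponent `C` the tail at level `t` becomes `(K/2) t^(-2)`,
integrable on `t > 1`; levels `t ≤ 1` contribute at most one. -/
lemma lintegral_exp_sq_le {X : Ω → ℝ} (hX : Measurable X) {C K : ℝ} (hC : 0 < C) (hK : 0 < K)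
    (htail : ∀ e : ℝ, 0 ≤ e → μ.real {ω | e ≤ |X ω|} ≤ 1 / 2 * K * Real.exp (-C * e ^ 2)) :
    ∫⁻ ω, ENNReal.ofReal (Real.exp (C / 2 * X ω ^ 2)) ∂μ ≤ ENNReal.ofReal (1 + K / 2) := by
  rw [lintegral_eq_lintegral_meas_le μ (ae_of_all _ fun ω => (Real.exp_pos _).le)
    (by fun_prop)]
  have hsplit : Set.Ioi (0 : ℝ) = Set.Ioc 0 1 ∪ Set.Ioi 1 := by
    rw [Set.Ioc_union_Ioi_eq_Ioi zero_le_one]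
  rw [hsplit, lintegral_union measurableSet_Ioi (Set.Ioc_disjoint_Ioi le_rfl),
    ENNReal.ofReal_add zero_le_one (by positivity)]
  refine add_le_add ?_ ?_
  · calc ∫⁻ t in Set.Ioc (0 : ℝ) 1, μ {a | t ≤ Real.exp (C / 2 * X a ^ 2)}
        ≤ ∫⁻ _ in Set.Ioc (0 : ℝ) 1, 1 := lintegral_mono fun t => prob_le_one
      _ = ENNReal.ofReal 1 := by simp
  · have hint : IntegrableOn (fun t : ℝ => K / 2 * t ^ (-2 : ℝ)) (Set.Ioi 1) :=
      (integrableOn_Ioi_rpow_of_lt (by norm_num) one_pos).const_mul _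
    calc ∫⁻ t in Set.Ioi (1 : ℝ), μ {a | t ≤ Real.exp (C / 2 * X a ^ 2)}
        ≤ ∫⁻ t in Set.Ioi (1 : ℝ), ENNReal.ofReal (K / 2 * t ^ (-2 : ℝ)) := by
          refine setLIntegral_mono (by fun_prop) fun t (ht : 1 < t) => ?_
          have ht0 : 0 < t := by linarith
          have hlog : 0 ≤ Real.log t := Real.log_nonneg ht.le
          have h1 := htail (Real.sqrt (2 / C * Real.log t)) (Real.sqrt_nonneg _)
          rw [Real.sq_sqrt (by positivity)] at h1
          have h2 : Real.exp (-C * (2 / C * Real.log t)) = t ^ (-2 : ℝ) := by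
            rw [Real.rpow_def_of_pos ht0]; congr 1; field_simp
          rw [h2] at h1
          rw [← ofReal_measureReal]
          refine ENNReal.ofReal_le_ofReal ((measureReal_mono fun ω hω => ?_).trans
            (h1.trans_eq (by ring)))
          simp only [Set.mem_ofPred_eq] at hω ⊢
          rw [← Real.log_le_iff_le_exp ht0] at hω
          refine Real.sqrt_le_iff.2 ⟨abs_nonneg _, ?_⟩
          rw [sq_abs, div_mul_eq_mul_div, div_le_iff₀ hC]
          linarith
      _ = ENNReal.ofReal (∫ t in Set.Ioi (1 : ℝ), K / 2 * t ^ (-2 : ℝ)) := by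
          rw [ofReal_integral_eq_lintegral_ofReal hint]
          filter_upwards [ae_restrict_mem measurableSet_Ioi] with t ht
          have : (0 : ℝ) < t := lt_trans one_pos ht
          simp only [Pi.zero_apply]
          positivity
      _ = ENNReal.ofReal (K / 2) := by
          rw [integral_const_mul, integral_Ioi_rpow_of_lt (by norm_num) one_pos]
          norm_num

/-- Subgaussian tails give `E X^{2k} ≤ (c k)^k` with an explicit constant. -/
lemma moments_of_subgaussian_tail {X : Ω → ℝ} (hX : Measurable X) {C K : ℝ} (hC : 0 < C)
    (hK : 0 < K)
    (htail : ∀ e : ℝ, 0 ≤ e → μ.real {ω | e ≤ |X ω|} ≤ 1 / 2 * K * Real.exp (-C * e ^ 2)) :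
    HasAllMoments X μ ∧
      ∀ k : ℕ, 1 ≤ k → ∫ ω, X ω ^ (2 * k) ∂μ ≤ ((1 + (2 + K) / C) * k) ^ k := by
  have hl := lintegral_exp_sq_le hX hC hK htail
  have hint : Integrable (fun ω => Real.exp (C / 2 * X ω ^ 2)) μ := by
    refine ⟨by fun_prop, ?_⟩
    rw [hasFiniteIntegral_iff_ofReal (ae_of_all _ fun ω => (Real.exp_pos _).le)]
    exact hl.trans_lt ENNReal.ofReal_lt_top
  have hle : ∫ ω, Real.exp (C / 2 * X ω ^ 2) ∂μ ≤ 1 + K / 2 := by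
    rw [← ENNReal.ofReal_le_ofReal_iff (by positivity),
      ofReal_integral_eq_lintegral_ofReal hint (ae_of_all _ fun ω => (Real.exp_pos _).le)]
    exact hl
  -- From `x^k / k! ≤ exp x` at `x = (C/2) X²`. The later bound `k! ≤ k^k` gives the constant `(2 +
  -- K)/C`; the extra `1` in the statement makes the constant at least one.
  have hpt : ∀ (k : ℕ) (ω : Ω), X ω ^ (2 * k)
      ≤ (2 / C) ^ k * k.factorial * Real.exp (C / 2 * X ω ^ 2) := by
    intro k ω
    have h1 := Real.pow_div_factorial_le_exp (x := C / 2 * X ω ^ 2) (by positivity) k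
    rw [div_le_iff₀ (by positivity)] at h1
    calc X ω ^ (2 * k) = (2 / C) ^ k * (C / 2 * X ω ^ 2) ^ k := by
          rw [← mul_pow, pow_mul]; congr 1; field_simp
      _ ≤ (2 / C) ^ k * (Real.exp (C / 2 * X ω ^ 2) * k.factorial) := by gcongr
      _ = _ := by ring
  have hk : ∀ k : ℕ, Integrable (fun ω => X ω ^ (2 * k)) μ := fun k =>
    (hint.const_mul _).mono' (by fun_prop) (ae_of_all _ fun ω => by
      rw [Real.norm_of_nonneg (by rw [pow_mul]; positivity)]
      exact hpt k ω)
  refine ⟨.of_even hX.aestronglyMeasurable hk, fun k hk1 => ?_⟩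
  calc ∫ ω, X ω ^ (2 * k) ∂μ
      ≤ ∫ ω, (2 / C) ^ k * k.factorial * Real.exp (C / 2 * X ω ^ 2) ∂μ :=
        integral_mono (hk k) (hint.const_mul _) (hpt k)
    _ = (2 / C) ^ k * k.factorial * ∫ ω, Real.exp (C / 2 * X ω ^ 2) ∂μ := integral_const_mul _ _
    _ ≤ (2 / C) ^ k * (k : ℝ) ^ k * (1 + K / 2) ^ k := by
        gcongr
        · exact_mod_cast Nat.factorial_le_pow k
        · exact hle.trans (le_self_pow₀ (by linarith) (by omega))
    _ = (((2 + K) / C) * k) ^ k := by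
        rw [← mul_pow, ← mul_pow]; congr 1; field_simp
    _ ≤ _ := by gcongr; linarith

omit [IsProbabilityMeasure μ] in
lemma integral_mul_pow_le {X Y : Ω → ℝ} (hX : HasAllMoments X μ) (hY : HasAllMoments Y μ)
    {n : ℕ} {B : ℝ} (hXB : ∫ ω, X ω ^ (2 * n) ∂μ ≤ B) (hYB : ∫ ω, Y ω ^ (2 * n) ∂μ ≤ B) :
    ∫ ω, (X ω * Y ω) ^ n ∂μ ≤ B := by
  calc ∫ ω, (X ω * Y ω) ^ n ∂μ
      ≤ ∫ ω, (1 / 2 * X ω ^ (2 * n) + 1 / 2 * Y ω ^ (2 * n)) ∂μ := by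
        refine integral_mono ((hX.mul hY).integrable_pow n)
          (((hX.integrable_pow _).const_mul _).add ((hY.integrable_pow _).const_mul _))
          fun ω => ?_
        have := two_mul_le_add_sq (X ω ^ n) (Y ω ^ n)
        simp only [mul_pow, two_mul, pow_add] at this ⊢
        nlinarith
    _ = 1 / 2 * ∫ ω, X ω ^ (2 * n) ∂μ + 1 / 2 * ∫ ω, Y ω ^ (2 * n) ∂μ := by
        rw [integral_add ((hX.integrable_pow _).const_mul _) ((hY.integrable_pow _).const_mul _),
          integral_const_mul, integral_const_mul]
    _ ≤ B := by linarith

lemma integral_mean_pow_le {T : ℕ} (hT : 1 ≤ T) {X : Fin T → Ω → ℝ}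
    (hX : ∀ t, HasAllMoments (X t) μ) {n : ℕ} (hn : Even n) {B : ℝ}
    (hXB : ∀ t, ∫ ω, X t ω ^ n ∂μ ≤ B) :
    ∫ ω, (1 / (T : ℝ) * ∑ t, X t ω) ^ n ∂μ ≤ B := by
  have hT0 : (T : ℝ) ≠ 0 := by positivity
  calc ∫ ω, (1 / (T : ℝ) * ∑ t, X t ω) ^ n ∂μ
      ≤ ∫ ω, ∑ t, 1 / (T : ℝ) * X t ω ^ n ∂μ := by
        refine integral_mono
          (((HasAllMoments.sum _ fun t _ => hX t).const_mul _).integrable_pow n)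
          (integrable_finsetSum _ fun t _ => ((hX t).integrable_pow n).const_mul _) fun ω => ?_
        have := Real.pow_arith_mean_le_arith_mean_pow_of_even Finset.univ
          (fun _ : Fin T => 1 / (T : ℝ)) (fun t => X t ω) (fun _ _ => by positivity)
          (by simp [hT0]) hn
        simpa only [Finset.mul_sum] using this
    _ = ∑ t, 1 / (T : ℝ) * ∫ ω, X t ω ^ n ∂μ := by
        rw [integral_finsetSum _ fun t _ => ((hX t).integrable_pow n).const_mul _]
        simp only [integral_const_mul]
    _ ≤ ∑ _t : Fin T, 1 / (T : ℝ) * B := by gcongr with t; exact hXB t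
    _ = B := by simp; field_simp

lemma integral_sub_integral_pow_le {W : Ω → ℝ} (hW : HasAllMoments W μ) {m : ℕ} {b : ℝ}
    (hWb : ∫ ω, W ω ^ (2 * m) ∂μ ≤ b ^ (2 * m)) :
    ∫ ω, (W ω - ∫ ω', W ω' ∂μ) ^ (2 * m) ∂μ ≤ (2 * b) ^ (2 * m) := by
  set e := ∫ ω', W ω' ∂μ with he
  have hm2 : Even (2 * m) := even_two_mul m
  have hjen : e ^ (2 * m) ≤ ∫ ω, W ω ^ (2 * m) ∂μ :=
    (hm2.convexOn_pow (𝕜 := ℝ)).map_integral_le (continuous_pow _).continuousOn isClosed_univ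
      (ae_of_all _ fun _ => Set.mem_univ _) hW.integrable (hW.integrable_pow _)
  have hpt : ∀ w : ℝ, (w - e) ^ (2 * m)
      ≤ 2 ^ (2 * m) * (1 / 2 * w ^ (2 * m) + 1 / 2 * e ^ (2 * m)) := by
    intro w
    have := (hm2.convexOn_pow (𝕜 := ℝ)).2 (Set.mem_univ w) (Set.mem_univ (-e))
      (by norm_num : (0 : ℝ) ≤ 1 / 2) (by norm_num : (0 : ℝ) ≤ 1 / 2) (by norm_num)
    simp only [smul_eq_mul, hm2.neg_pow] at this
    calc (w - e) ^ (2 * m) = 2 ^ (2 * m) * (1 / 2 * w + 1 / 2 * -e) ^ (2 * m) := by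
          rw [← mul_pow]; ring_nf
      _ ≤ _ := by gcongr
  calc ∫ ω, (W ω - e) ^ (2 * m) ∂μ
      ≤ ∫ ω, 2 ^ (2 * m) * (1 / 2 * W ω ^ (2 * m) + 1 / 2 * e ^ (2 * m)) ∂μ := by
        refine integral_mono ?_ ((((hW.integrable_pow _).const_mul _).add
          (integrable_const _)).const_mul _) fun ω => hpt _
        simpa only [sub_eq_add_neg] using (hW.add (HasAllMoments.const (-e))).integrable_pow (2 * m)
    _ = 2 ^ (2 * m) * (1 / 2 * ∫ ω, W ω ^ (2 * m) ∂μ + 1 / 2 * e ^ (2 * m)) := by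
        rw [integral_const_mul, integral_add ((hW.integrable_pow _).const_mul _)
          (integrable_const _), integral_const_mul]
        simp
    _ ≤ 2 ^ (2 * m) * b ^ (2 * m) := by gcongr; linarith
    _ = _ := (mul_pow _ _ _).symm

end Tails

/-! ### Deterministic Lasso theory: oracle inequality, restricted eigenvalue, weak sparsity. -/

lemma sum_abs_sub_le_sum_abs_add {ι : Type*} [Fintype ι] [DecidableEq ι] (a u : ι → ℝ)
    (J : Finset ι) :
    ∑ j, |a j| - ∑ j ∈ J, |u j| + ∑ j ∈ Jᶜ, |u j| - 2 * ∑ j ∈ Jᶜ, |a j| ≤ ∑ j, |a j + u j| := by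
  rw [← Finset.sum_add_sum_compl J fun j => |a j|,
    ← Finset.sum_add_sum_compl J fun j => |a j + u j|]
  have h1 : ∑ j ∈ J, |a j| ≤ ∑ j ∈ J, |a j + u j| + ∑ j ∈ J, |u j| := by
    rw [← Finset.sum_add_distrib]
    refine Finset.sum_le_sum fun j _ => ?_
    have := abs_sub_abs_le_abs_sub (a j) (-u j)
    rw [abs_neg, sub_neg_eq_add] at this
    linarith
  have h2 : ∑ j ∈ Jᶜ, |u j| ≤ ∑ j ∈ Jᶜ, |a j + u j| + ∑ j ∈ Jᶜ, |a j| := by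
    rw [← Finset.sum_add_distrib]
    refine Finset.sum_le_sum fun j _ => ?_
    have := abs_sub_abs_le_abs_sub (u j) (-a j)
    rw [abs_neg, sub_neg_eq_add, add_comm (u j)] at this
    linarith
  linarith

/-- Deterministic oracle inequality for a Lasso with a strongly sparse block `α` and a weakly
sparse block `w`, in terms of the errors `u` and `v` and of the normalised prediction error `Q`. -/
lemma lasso_oracle_inequality {ι κ : Type*} [Fintype ι] [DecidableEq ι] [Fintype κ] [DecidableEq κ]
    (α u : ι → ℝ) (w v : κ → ℝ) (J₁ : Finset ι) (J₂ : Finset κ)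
    {Q l e S τ k : ℝ} (hQ0 : 0 ≤ Q) (hl : 0 < l) (he : 0 ≤ e) (hS : 0 ≤ S) (hk : 0 < k)
    (hk1 : k ≤ 1)
    (hbasic : Q + 2 * l * (∑ j, |α j + u j| + ∑ i, |w i + v i|)
      ≤ l * (∑ j, |u j| + ∑ i, |v i|) + 2 * l * (∑ j, |α j| + ∑ i, |w i|))
    (hα : ∀ j ∉ J₁, α j = 0) (hw : ∑ i ∈ J₂ᶜ, |w i| ≤ e)
    (hJ₁ : (J₁.card : ℝ) ≤ S) (hJ₂ : (J₂.card : ℝ) ≤ S)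
    (hcone : ∑ j ∈ J₁ᶜ, |u j| ≤ 4 * ∑ j ∈ J₁, |u j| →
      k * ∑ j ∈ J₁, u j ^ 2 + ∑ i, v i ^ 2 ≤ Q + 3 * τ * (∑ j, |u j| + ∑ i, |v i|) ^ 2)
    (hQ : ∑ i, v i ^ 2 ≤ Q + 3 * τ * (∑ j, |u j| + ∑ i, |v i|) ^ 2)
    (hτ : 0 ≤ τ) (hsmall : 9600 * S * τ ≤ k) :
    Q ≤ 3200 / k * (l * (S * l + e)) ∧
      ∑ j, |u j| + ∑ i, |v i| ≤ 3200 / k * (S * l + e) := by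
  have hα1 := sum_abs_sub_le_sum_abs_add α u J₁
  have hα2 : ∑ j ∈ J₁ᶜ, |α j| = 0 := Finset.sum_eq_zero fun j hj => by
    rw [hα j (by simpa using hj), abs_zero]
  have hw1 := sum_abs_sub_le_sum_abs_add w v J₂
  have hu := Finset.sum_add_sum_compl J₁ fun j => |u j|
  have hv := Finset.sum_add_sum_compl J₂ fun i => |v i|
  have p1 : 0 ≤ ∑ j ∈ J₁, |u j| := Finset.sum_nonneg fun _ _ => abs_nonneg _
  have p2 : 0 ≤ ∑ j ∈ J₁ᶜ, |u j| := Finset.sum_nonneg fun _ _ => abs_nonneg _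
  have p3 : 0 ≤ ∑ j ∈ J₂, |v j| := Finset.sum_nonneg fun _ _ => abs_nonneg _
  have p4 : 0 ≤ ∑ j ∈ J₂ᶜ, |v j| := Finset.sum_nonneg fun _ _ => abs_nonneg _
  have c1 : (∑ j ∈ J₁, |u j|) ^ 2 ≤ S * ∑ j ∈ J₁, u j ^ 2 := by
    have := sq_sum_le_card_mul_sum_sq (s := J₁) (f := fun j => |u j|)
    simp only [sq_abs] at this
    exact this.trans (mul_le_mul_of_nonneg_right hJ₁ (Finset.sum_nonneg fun _ _ => sq_nonneg _))
  have c2 : (∑ i ∈ J₂, |v i|) ^ 2 ≤ S * ∑ i, v i ^ 2 := by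
    have := sq_sum_le_card_mul_sum_sq (s := J₂) (f := fun i => |v i|)
    simp only [sq_abs] at this
    exact this.trans (mul_le_mul hJ₂ (Finset.sum_le_sum_of_subset_of_nonneg
      (Finset.subset_univ _) fun _ _ _ => sq_nonneg _)
      (Finset.sum_nonneg fun _ _ => sq_nonneg _) hS)
  have q1 : 0 ≤ ∑ j ∈ J₁, u j ^ 2 := Finset.sum_nonneg fun _ _ => sq_nonneg _
  have q2 : 0 ≤ ∑ i, v i ^ 2 := Finset.sum_nonneg fun _ _ => sq_nonneg _
  rw [← hu, ← hv] at hbasic hcone hQ ⊢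
  clear hu hv
  generalize ∑ j ∈ J₁, |u j| = U at *
  generalize ∑ j ∈ J₁ᶜ, |u j| = U' at *
  generalize ∑ j ∈ J₂, |v j| = V at *
  generalize ∑ j ∈ J₂ᶜ, |v j| = V' at *
  generalize ∑ j ∈ J₁, u j ^ 2 = U2 at *
  generalize ∑ i, v i ^ 2 = V2 at *
  -- The usual cone inequality; weak sparsity adds the approximation error `4 e`.
  have key : Q + l * (U' + V') ≤ l * (3 * (U + V) + 4 * e) := by
    have : 2 * l * (∑ j, |α j| - U + U' + (∑ i, |w i| - V + V' - 2 * e))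
        ≤ 2 * l * (∑ j, |α j + u j| + ∑ i, |w i + v i|) := by
      gcongr
      · linarith
      · linarith
    linarith
  have key' : U' + V' ≤ 3 * (U + V) + 4 * e := by
    refine le_of_mul_le_mul_left ?_ hl
    linarith
  set W := U + U' + (V + V') with hW
  have hk3 : 3200 ≤ 3200 / k := by rw [le_div_iff₀ hk]; linarith
  have hSl : 0 ≤ S * l + e := by positivity
  -- If `U + V ≤ 8 e` the approximation error dominates and the cone inequality alone suffices.
  -- Otherwise `4 e ≤ (U + V)/2` is absorbed.
  rcases le_or_gt (U + V) (8 * e) with h8 | h8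
  · have hlb : 3200 * (S * l + e) ≤ 3200 / k * (S * l + e) := by gcongr
    have hSl0 : 0 ≤ S * l := by positivity
    constructor
    · have h1 : Q ≤ l * (28 * e) := by
        have : l * (3 * (U + V) + 4 * e) ≤ l * (28 * e) := by gcongr; linarith
        have h0 : 0 ≤ l * (U' + V') := by positivity
        linarith
      have h2 : l * (28 * e) ≤ l * (3200 / k * (S * l + e)) :=
        mul_le_mul_of_nonneg_left (by linarith) hl.le
      linarith
    · linarith
  · have hW5 : W ≤ 5 * (U + V) := by linarith
    have hW0 : 0 ≤ W := by positivity
    set R := Q + 3 * τ * W ^ 2 with hR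
    have hR0 : 0 ≤ R := by positivity
    have main : k * (U + V) ^ 2 ≤ 64 * S * R := by
      by_cases hc : U' ≤ 4 * U
      · have h1 := hcone hc
        have h2 : k * V2 ≤ V2 := mul_le_of_le_one_left q2 hk1
        have h3 : (U + V) ^ 2 ≤ 2 * (S * U2 + S * V2) := by nlinarith [sq_nonneg (U - V)]
        have h4 : S * (k * U2 + k * V2) ≤ S * R := by gcongr; linarith
        have h5 : k * (U + V) ^ 2 ≤ k * (2 * (S * U2 + S * V2)) := by gcongr
        have h6 := mul_nonneg hS hR0
        linarith
      -- Off the `α`-cone, `4 U < U' ≤ 3.5 (U + V)` forces `U < 7 V`: the fixed effects dominate,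
      -- and their block has eigenvalue one, so no restricted eigenvalue is needed.
      · push Not at hc
        have h1 : U + V ≤ 8 * V := by linarith
        have h2 : (U + V) ^ 2 ≤ 64 * (S * V2) := by
          have : (U + V) ^ 2 ≤ (8 * V) ^ 2 := by gcongr
          linarith
        have h3 : S * V2 ≤ S * R := by gcongr
        have h4 : k * (U + V) ^ 2 ≤ 1 * (U + V) ^ 2 := by gcongr
        linarith
    have hWsq : W ^ 2 ≤ 25 * (U + V) ^ 2 := by
      calc W ^ 2 ≤ (5 * (U + V)) ^ 2 := by gcongr
        _ = _ := by ring
    -- The Gram error contributes at most `64 · 3 · 25 S τ (U + V)² = 4800 S τ (U + V)²`, which is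
    -- at most half of the left side by `hsmall`.
    have h5 : k * (U + V) ^ 2 ≤ 128 * S * Q := by
      have h6 : 64 * S * (3 * τ * W ^ 2) ≤ 64 * S * (3 * τ * (25 * (U + V) ^ 2)) := by gcongr
      have h7 : 9600 * S * τ * (U + V) ^ 2 ≤ k * (U + V) ^ 2 := by gcongr
      rw [hR, mul_add] at main
      linarith
    -- `3200 = 25 · 128`, so that `Y² ≤ D Q`. Together with `Q ≤ Y` this yields `Y ≤ D`.
    set D := 3200 / k * (S * l ^ 2) with hD
    have hD0 : 0 ≤ D := by positivity
    set Y := l * (5 * (U + V)) with hY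
    have hY0 : 0 ≤ Y := by positivity
    have hYD : Y ^ 2 ≤ D * Q := by
      rw [hY, hD, div_mul_eq_mul_div, div_mul_eq_mul_div, le_div_iff₀ hk]
      have := mul_le_mul_of_nonneg_left h5 (by positivity : 0 ≤ 25 * l ^ 2)
      linarith
    have hQW : Q + l * W ≤ Y := by
      have : l * (3 * (U + V) + 4 * e) + l * (U + V) ≤ Y := by
        rw [hY, ← mul_add]; gcongr; linarith
      rw [hW]; linarith
    have hQY : Q ≤ Y := by
      have : 0 ≤ l * W := by positivity
      linarith
    have hYD' : Y ≤ D := by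
      by_contra! hlt
      have h6 : D * Q ≤ D * Y := by gcongr
      have h7 : D * Y < Y * Y := mul_lt_mul_of_pos_right hlt (hD0.trans_lt hlt)
      rw [← sq] at h7
      exact absurd (h7.trans_le (hYD.trans h6)) (lt_irrefl _)
    constructor
    · refine (hQY.trans hYD').trans ?_
      have : l * (S * l) ≤ l * (S * l + e) := by gcongr; linarith
      calc D = 3200 / k * (l * (S * l)) := by rw [hD]; ring
        _ ≤ _ := by gcongr
    · refine le_of_mul_le_mul_left ?_ hl
      calc l * W ≤ D := by linarith
        _ = l * (3200 / k * (S * l)) := by rw [hD]; ring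
        _ ≤ _ := by gcongr; linarith

lemma restrictedEigenvalueSq_le_quadratic {ι : Type*} [Fintype ι] [DecidableEq ι]
    {A : Matrix ι ι ℝ} {r : ℕ} {k : ℝ} (hk : 0 < k) (h : k ≤ restrictedEigenvalueSq A r)
    {R : Finset ι} (hR : R.card ≤ r) {d : ι → ℝ}
    (hd : ∑ j ∈ Rᶜ, |d j| ≤ 4 * ∑ j ∈ R, |d j|) :
    k * ∑ j ∈ R, d j ^ 2 ≤ d ⬝ᵥ A.mulVec d := by
  rcases eq_or_ne d 0 with rfl | hd0
  · simp
  · set s := {v : ℝ | ∃ (R : Finset ι) (δ : ι → ℝ), R.card ≤ r ∧ δ ≠ 0 ∧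
      ∑ j ∈ Rᶜ, |δ j| ≤ 4 * ∑ j ∈ R, |δ j| ∧ v = (δ ⬝ᵥ A.mulVec δ) / ∑ j ∈ R, δ j ^ 2} with hs
    have hks : k ≤ sInf s := h.trans (min_le_right _ _)
    -- An unbounded set would have `sInf` equal to the default `0`, contradicting `0 < k ≤ sInf s`.
    have hbdd : BddBelow s := by
      by_contra hb
      rw [Real.sInf_of_not_bddBelow hb] at hks
      linarith
    have hle := hks.trans (csInf_le hbdd ⟨R, d, hR, hd0, hd, rfl⟩)
    -- The quotient has no junk value: if `d` vanished on `R`, the cone condition would force `d =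
    -- 0`.
    have hpos : 0 < ∑ j ∈ R, d j ^ 2 := by
      refine lt_of_le_of_ne (Finset.sum_nonneg fun _ _ => sq_nonneg _) fun h0 => ?_
      have hz : ∀ j ∈ R, d j = 0 := fun j hj => by
        have := (Finset.sum_eq_zero_iff_of_nonneg fun _ _ => sq_nonneg _).1 h0.symm j hj
        exact pow_eq_zero_iff two_ne_zero |>.1 this
      have hR0 : ∑ j ∈ R, |d j| = 0 := Finset.sum_eq_zero fun j hj => by rw [hz j hj, abs_zero]
      rw [hR0, mul_zero] at hd
      have hRc := (Finset.sum_eq_zero_iff_of_nonneg fun _ _ => abs_nonneg _).1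
        (le_antisymm hd (Finset.sum_nonneg fun _ _ => abs_nonneg _))
      refine hd0 (funext fun j => ?_)
      by_cases hj : j ∈ R
      · exact hz j hj
      · exact abs_eq_zero.1 (hRc j (by simpa using hj))
    rwa [le_div_iff₀ hpos] at hle

lemma restrictedEigenvalueSq_le_one {ι : Type*} [Fintype ι] [DecidableEq ι]
    (A : Matrix ι ι ℝ) (r : ℕ) : restrictedEigenvalueSq A r ≤ 1 := min_le_left _ _

/-- Weak sparsity: the number of coordinates above a threshold and the mass below it. -/
lemma card_and_tail_of_weakly_sparse {κ : Type*} [Fintype κ] [DecidableEq κ] {h : κ → ℝ}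
    {ν E x : ℝ} (hν : 0 < ν) (hν1 : ν < 1) (hx : 0 < x) (hE : ∑ i, |h i| ^ ν ≤ E) :
    ((Finset.univ.filter fun i => x < |h i|).card : ℝ) ≤ E * x ^ (-ν) ∧
      ∑ i ∈ (Finset.univ.filter fun i => x < |h i|)ᶜ, |h i| ≤ E * x ^ (1 - ν) := by
  set J := Finset.univ.filter fun i => x < |h i| with hJ
  have hnn : ∀ i, 0 ≤ |h i| ^ ν := fun i => Real.rpow_nonneg (abs_nonneg _) _
  constructor
  · rw [Real.rpow_neg hx.le, ← div_eq_mul_inv, le_div_iff₀ (Real.rpow_pos_of_pos hx _)]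
    refine le_trans ?_ hE
    calc (J.card : ℝ) * x ^ ν = ∑ i ∈ J, x ^ ν := by simp
      _ ≤ ∑ i ∈ J, |h i| ^ ν := Finset.sum_le_sum fun i hi =>
          Real.rpow_le_rpow hx.le (Finset.mem_filter.1 hi).2.le hν.le
      _ ≤ _ := Finset.sum_le_sum_of_subset_of_nonneg (Finset.subset_univ _) fun i _ _ => hnn i
  · calc ∑ i ∈ Jᶜ, |h i| ≤ ∑ i ∈ Jᶜ, |h i| ^ ν * x ^ (1 - ν) := by
          refine Finset.sum_le_sum fun i hi => ?_
          have hi' : |h i| ≤ x := by simpa [hJ] using hi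
          calc |h i| = |h i| ^ ν * |h i| ^ (1 - ν) := by
                rw [← Real.rpow_add_of_nonneg (abs_nonneg _) hν.le (by linarith)]; simp
            _ ≤ _ := by gcongr
      _ = (∑ i ∈ Jᶜ, |h i| ^ ν) * x ^ (1 - ν) := (Finset.sum_mul _ _ _).symm
      _ ≤ E * x ^ (1 - ν) := by
          gcongr
          exact (Finset.sum_le_sum_of_subset_of_nonneg (Finset.subset_univ _)
            fun i _ _ => hnn i).trans hE

/-! ### Algebra of the panel design and the error bounds on the good event. -/

namespace DynamicPanel

variable {Ω : Type*} [MeasurableSpace Ω] {N T L q : ℕ}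

lemma design_mulVec (P : DynamicPanel Ω N T L q) (ω : Ω) (u : Fin L ⊕ Fin q → ℝ) (k : Fin N → ℝ)
    (r : Fin N × Fin T) :
    (P.design ω).mulVec (Sum.elim u k) r = ∑ j, P.z r.1 r.2 j ω * u j + k r.1 := by
  simp only [design, Matrix.fromCols_mulVec_sumElim]
  simp [Matrix.mulVec, dotProduct, Z]

lemma y_eq_design_add_error (P : DynamicPanel Ω N T L q) (ω : Ω) (r : Fin N × Fin T) :
    P.y r.1 ((r.2 : ℤ) + 1) ω = (P.design ω).mulVec (Sum.elim P.α P.η) r + P.ε r.1 r.2 ω := by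
  rw [P.model_eq, design_mulVec, Fintype.sum_sum_type]
  simp only [z, Sum.elim_inl, Sum.elim_inr]
  simp only [mul_comm]

lemma sum_error_mul_design (P : DynamicPanel Ω N T L q) (ω : Ω) (u : Fin L ⊕ Fin q → ℝ)
    (k : Fin N → ℝ) :
    ∑ r : Fin N × Fin T, P.ε r.1 r.2 ω * (P.design ω).mulVec (Sum.elim u k) r
      = ∑ j, u j * (∑ r : Fin N × Fin T, P.z r.1 r.2 j ω * P.ε r.1 r.2 ω)
        + ∑ i, k i * ∑ t, P.ε i t ω := by
  simp only [design_mulVec, mul_add, Finset.sum_add_distrib]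
  congr 1
  · simp only [Finset.mul_sum]
    rw [Finset.sum_comm]
    exact Finset.sum_congr rfl fun j _ => Finset.sum_congr rfl fun r _ => by ring
  · rw [Fintype.sum_prod_type]
    simp only [Finset.mul_sum]
    exact Finset.sum_congr rfl fun j _ => Finset.sum_congr rfl fun r _ => by ring

lemma abs_sum_mul_le {ι : Type*} [Fintype ι] {u x : ι → ℝ} {c : ℝ} (hx : ∀ j, |x j| ≤ c) :
    |∑ j, u j * x j| ≤ c * ∑ j, |u j| := by
  refine (Finset.abs_sum_le_sum_abs _ _).trans ?_
  rw [Finset.mul_sum]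
  refine Finset.sum_le_sum fun j _ => ?_
  rw [abs_mul, mul_comm]
  gcongr
  exact hx j

/-- The basic inequality of the Lasso on the event where the penalty dominates the noise. -/
lemma basic_inequality (P : DynamicPanel Ω N T L q) (ω : Ω) {lam : ℝ}
    {a : Fin L ⊕ Fin q → ℝ} {h : Fin N → ℝ}
    (hmin : P.lassoObjective lam ω (a, h) ≤ P.lassoObjective lam ω (P.α, P.η))
    (hz : ∀ j, |∑ r : Fin N × Fin T, P.z r.1 r.2 j ω * P.ε r.1 r.2 ω| ≤ lam / 2)
    (hd : ∀ i, |∑ t, P.ε i t ω| ≤ lam / Real.sqrt N / 2) :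
    ∑ r : Fin N × Fin T, (P.design ω).mulVec (Sum.elim (a - P.α) (h - P.η)) r ^ 2
      + 2 * lam * ∑ j, |a j| + 2 * (lam / Real.sqrt N) * ∑ i, |h i|
    ≤ lam * ∑ j, |(a - P.α) j| + lam / Real.sqrt N * ∑ i, |(h - P.η) i|
      + (2 * lam * ∑ j, |P.α j| + 2 * (lam / Real.sqrt N) * ∑ i, |P.η i|) := by
  have hres : ∀ r : Fin N × Fin T, (P.y r.1 ((r.2 : ℤ) + 1) ω
      - (P.design ω).mulVec (Sum.elim a h) r) ^ 2
      = (P.y r.1 ((r.2 : ℤ) + 1) ω - (P.design ω).mulVec (Sum.elim P.α P.η) r) ^ 2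
        + (P.design ω).mulVec (Sum.elim (a - P.α) (h - P.η)) r ^ 2
        - 2 * (P.ε r.1 r.2 ω * (P.design ω).mulVec (Sum.elim (a - P.α) (h - P.η)) r) := by
    intro r
    have : Sum.elim (a - P.α) (h - P.η) = Sum.elim a h - Sum.elim P.α P.η := by
      ext i; rcases i with i | i <;> rfl
    rw [this, Matrix.mulVec_sub, Pi.sub_apply, y_eq_design_add_error]
    ring
  simp only [lassoObjective, hres, Finset.sum_sub_distrib, Finset.sum_add_distrib,
    ← Finset.mul_sum, sum_error_mul_design] at hmin
  have h1 := (abs_le.1 (abs_sum_mul_le (u := a - P.α) hz)).2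
  have h2 := (abs_le.1 (abs_sum_mul_le (u := h - P.η) hd)).2
  linarith

/-- The factor `√N` compensates for each dummy having only `T` of the `NT` observations: the
fixed-effect block becomes the identity, and the cross block gains a factor `1/√N` that makes it
negligible. -/
lemma sum_design_sq (P : DynamicPanel Ω N T L q) (hN : 1 ≤ N) (hT : 1 ≤ T) (ω : Ω)
    (u : Fin L ⊕ Fin q → ℝ) (v : Fin N → ℝ) :
    1 / ((N : ℝ) * T) * ∑ r : Fin N × Fin T,
        (P.design ω).mulVec (Sum.elim u fun i => Real.sqrt N * v i) r ^ 2
      = 1 / ((N : ℝ) * T) * ∑ r : Fin N × Fin T, (∑ j, P.z r.1 r.2 j ω * u j) ^ 2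
        + 2 * (∑ i, v i * ∑ j, u j * (1 / Real.sqrt N * (1 / (T : ℝ) * ∑ t, P.z i t j ω)))
        + ∑ i, v i ^ 2 := by
  have hN0 : (0 : ℝ) < N := by exact_mod_cast hN
  have hT0 : (0 : ℝ) < T := by exact_mod_cast hT
  have hs : Real.sqrt N ≠ 0 := (Real.sqrt_pos.2 hN0).ne'
  have hs2 : Real.sqrt N ^ 2 = N := Real.sq_sqrt hN0.le
  simp only [design_mulVec, add_sq, Finset.sum_add_distrib, mul_add]
  congr 1
  · congr 1
    have e1 : ∑ r : Fin N × Fin T, 2 * (∑ j, P.z r.1 r.2 j ω * u j) * (Real.sqrt N * v r.1)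
        = 2 * Real.sqrt N * ∑ i, v i * ∑ j, u j * ∑ t, P.z i t j ω := by
      rw [Fintype.sum_prod_type, Finset.mul_sum]
      refine Finset.sum_congr rfl fun i _ => ?_
      simp only [Finset.mul_sum, Finset.sum_mul]
      rw [Finset.sum_comm]
      exact Finset.sum_congr rfl fun j _ => Finset.sum_congr rfl fun t _ => by ring
    have e2 : ∑ i, v i * ∑ j, u j * (1 / Real.sqrt N * (1 / (T : ℝ) * ∑ t, P.z i t j ω))
        = 1 / Real.sqrt N * (1 / T) * ∑ i, v i * ∑ j, u j * ∑ t, P.z i t j ω := by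
      simp only [Finset.mul_sum]
      exact Finset.sum_congr rfl fun i _ => Finset.sum_congr rfl fun j _ =>
        Finset.sum_congr rfl fun t _ => by ring
    rw [e1, e2]
    generalize ∑ i, v i * ∑ j, u j * ∑ t, P.z i t j ω = X
    field_simp
    rw [hs2]
  · rw [Fintype.sum_prod_type]
    simp only [Finset.sum_const, Finset.card_univ, Fintype.card_fin, nsmul_eq_mul, mul_pow, hs2,
      ← Finset.mul_sum]
    field_simp

lemma abs_sample_gram_sub_le (P : DynamicPanel Ω N T L q) (ω : Ω) {τ : ℝ}
    (A : Matrix (Fin L ⊕ Fin q) (Fin L ⊕ Fin q) ℝ) (u : Fin L ⊕ Fin q → ℝ)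
    (hA : ∀ j k, |1 / ((N : ℝ) * T) * ∑ i, ∑ t, P.z i t j ω * P.z i t k ω - A j k| ≤ τ) :
    |1 / ((N : ℝ) * T) * ∑ r : Fin N × Fin T, (∑ j, P.z r.1 r.2 j ω * u j) ^ 2
      - u ⬝ᵥ A.mulVec u| ≤ τ * (∑ j, |u j|) ^ 2 := by
  have e : 1 / ((N : ℝ) * T) * ∑ r : Fin N × Fin T, (∑ j, P.z r.1 r.2 j ω * u j) ^ 2
      - u ⬝ᵥ A.mulVec u = ∑ j, u j * ∑ k, u k *
        (1 / ((N : ℝ) * T) * ∑ i, ∑ t, P.z i t j ω * P.z i t k ω - A j k) := by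
    simp only [dotProduct, Matrix.mulVec, mul_sub, Finset.sum_sub_distrib]
    congr 1
    · have e0 : ∀ j k, ∑ i, ∑ t, P.z i t j ω * P.z i t k ω
          = ∑ r : Fin N × Fin T, P.z r.1 r.2 j ω * P.z r.1 r.2 k ω := fun j k =>
        (Fintype.sum_prod_type' fun i t => P.z i t j ω * P.z i t k ω).symm
      simp only [e0, sq, Finset.sum_mul_sum]
      simp only [Finset.mul_sum]
      rw [Finset.sum_comm]
      refine Finset.sum_congr rfl fun j _ => ?_
      rw [Finset.sum_comm]
      exact Finset.sum_congr rfl fun k _ => Finset.sum_congr rfl fun r _ => by ring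
    · refine Finset.sum_congr rfl fun j _ => ?_
      congr 1
      exact Finset.sum_congr rfl fun k _ => mul_comm _ _
  rw [e]
  refine (abs_sum_mul_le (c := τ * ∑ j, |u j|) fun j => abs_sum_mul_le fun k => hA j k).trans_eq ?_
  ring

set_option maxHeartbeats 1000000 in
/-- The oracle inequalities for the panel Lasso on the event where the penalty dominates the noise
and the scaled Gram matrix is close to its population counterpart. -/
lemma lasso_error_bounds (P : DynamicPanel Ω N T L q) (hN : 1 ≤ N) (hT : 1 ≤ T) (ω : Ω)
    {lam ν E κ₀ τ x : ℝ} {s : ℕ} (hlam : 0 < lam) (hν : 0 < ν) (hν1 : ν < 1) (hκ₀ : 0 < κ₀)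
    (hE : 0 < E) (hx : x = lam / (Real.sqrt N * T))
    {A : Matrix (Fin L ⊕ Fin q) (Fin L ⊕ Fin q) ℝ} (hA : κ₀ ≤ restrictedEigenvalueSq A s)
    (hclass : (P.α, P.η) ∈ sparseClass s ν E)
    {a : Fin L ⊕ Fin q → ℝ} {h : Fin N → ℝ}
    (hmin : P.lassoObjective lam ω (a, h) ≤ P.lassoObjective lam ω (P.α, P.η))
    (hz : ∀ j, |∑ r : Fin N × Fin T, P.z r.1 r.2 j ω * P.ε r.1 r.2 ω| ≤ lam / 2)
    (hd : ∀ i, |∑ t, P.ε i t ω| ≤ lam / Real.sqrt N / 2)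
    (hgram : ∀ j k, |1 / ((N : ℝ) * T) * ∑ i, ∑ t, P.z i t j ω * P.z i t k ω - A j k| ≤ τ)
    (hcross : ∀ i j, |1 / Real.sqrt N * (1 / (T : ℝ) * ∑ t, P.z i t j ω)| ≤ τ)
    (hτ : 0 ≤ τ) (hsmall : 9600 * (s + E * x ^ (-ν)) * τ ≤ κ₀) :
    P.predictionError ω a h ≤ 3200 / κ₀ * (s * (lam / ((N : ℝ) * T)) ^ 2
        + lam / (Real.sqrt N * ((N : ℝ) * T)) * E * x ^ (1 - ν)) * 2 ∧
      ∑ j, |a j - P.α j| ≤ 3200 / κ₀ * (s * (lam / ((N : ℝ) * T))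
        + 1 / Real.sqrt N * E * x ^ (1 - ν)) * 2 ∧
      ∑ i, |h i - P.η i| ≤ 3200 / κ₀ * (s * (lam / (Real.sqrt N * T)) + E * x ^ (1 - ν)) * 2 := by
  have hN0 : (0 : ℝ) < N := by exact_mod_cast hN
  have hT0 : (0 : ℝ) < T := by exact_mod_cast hT
  set b := Real.sqrt N with hb
  have hb0 : 0 < b := Real.sqrt_pos.2 hN0
  have hb2 : b ^ 2 = N := Real.sq_sqrt hN0.le
  have hx0 : 0 < x := by rw [hx]; positivity
  have hxE : 0 < x ^ (-ν) := Real.rpow_pos_of_pos hx0 _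
  have hxE' : 0 < x ^ (1 - ν) := Real.rpow_pos_of_pos hx0 _
  obtain ⟨hcard, htail⟩ := card_and_tail_of_weakly_sparse hν hν1 hx0 hclass.2
  set J₂ := Finset.univ.filter fun i => x < |P.η i| with hJ₂
  set J₁ := Finset.univ.filter fun j => P.α j ≠ 0 with hJ₁
  have hJ₁s : J₁.card ≤ s := by
    have h1 : {j | P.α j ≠ 0}.ncard ≤ s := hclass.1
    rwa [Set.ncard_eq_toFinset_card', Set.toFinset_ofPred] at h1
  set u := a - P.α with hu
  set v : Fin N → ℝ := fun i => (h i - P.η i) / b with hv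
  set w : Fin N → ℝ := fun i => P.η i / b with hw
  set l := lam / ((N : ℝ) * T) with hl
  have hl0 : 0 < l := by positivity
  have hhv : (fun i => b * v i) = h - P.η := by
    ext i; simp only [hv, Pi.sub_apply]; field_simp
  have hpe : P.predictionError ω a h
      = 1 / ((N : ℝ) * T) * ∑ r : Fin N × Fin T,
        (P.design ω).mulVec (Sum.elim u fun i => b * v i) r ^ 2 := by
    rw [predictionError, hhv]
  have hsq := sum_design_sq P hN hT ω u v
  have hgr := abs_le.1 (abs_sample_gram_sub_le P ω A u hgram)
  have hcr := abs_le.1 (abs_sum_mul_le (u := v) fun i =>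
    abs_sum_mul_le (u := u) fun j => hcross i j)
  have hbase := basic_inequality P ω hmin hz hd
  rw [← hhv, ← hu] at hbase
  have hΔ : ∑ i, |b * v i| = b * ∑ i, |v i| := by
    simp only [abs_mul, abs_of_pos hb0, Finset.mul_sum]
  have hη : ∑ i, |P.η i| = b * ∑ i, |w i| := by
    simp only [hw, abs_div, abs_of_pos hb0, Finset.mul_sum]
    exact Finset.sum_congr rfl fun i _ => by field_simp
  have hh : ∑ i, |h i| = b * ∑ i, |w i + v i| := by
    rw [Finset.mul_sum]
    refine Finset.sum_congr rfl fun i _ => ?_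
    have : h i = b * (w i + v i) := by simp only [hw, hv]; field_simp; ring
    rw [this, abs_mul, abs_of_pos hb0]
  have ha : ∑ j, |a j| = ∑ j, |P.α j + u j| := by simp [hu]
  have hQ0 : 0 ≤ P.predictionError ω a h := by
    rw [hpe]; exact mul_nonneg (by positivity) (Finset.sum_nonneg fun _ _ => sq_nonneg _)
  have hn1 : 0 ≤ ∑ j, |u j| := Finset.sum_nonneg fun _ _ => abs_nonneg _
  have hn2 : 0 ≤ ∑ i, |v i| := Finset.sum_nonneg fun _ _ => abs_nonneg _
  -- Collects the cross error (twice) and the Gram error. Off the cone only the cross error matters,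
  -- since the quadratic form in `Z` is nonnegative.
  have hprod : 2 * (τ * ((∑ j, |u j|) * ∑ i, |v i|)) + τ * (∑ j, |u j|) ^ 2
      ≤ 3 * τ * (∑ j, |u j| + ∑ i, |v i|) ^ 2 := by
    nlinarith [mul_nonneg hτ (mul_nonneg hn1 hn2), mul_nonneg hτ (sq_nonneg (∑ j, |u j|)),
      mul_nonneg hτ (sq_nonneg (∑ i, |v i|))]
  have hprod' : 0 ≤ τ * (∑ j, |u j|) ^ 2 := by positivity
  have hZ0 : 0 ≤ 1 / ((N : ℝ) * T) * ∑ r : Fin N × Fin T, (∑ j, P.z r.1 r.2 j ω * u j) ^ 2 :=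
    mul_nonneg (by positivity) (Finset.sum_nonneg fun _ _ => sq_nonneg _)
  obtain ⟨hc1, hc2⟩ := lasso_oracle_inequality P.α u w v J₁ J₂
    (Q := P.predictionError ω a h) (l := l) (e := 1 / b * E * x ^ (1 - ν))
    (S := s + E * x ^ (-ν)) (τ := τ) (k := κ₀) hQ0 hl0 (by positivity) (by positivity) hκ₀
    (hA.trans (restrictedEigenvalueSq_le_one _ _))
    (by
      rw [hpe, hl]
      rw [hΔ, hη, hh, ha] at hbase
      have h1 := mul_le_mul_of_nonneg_left hbase (by positivity : 0 ≤ 1 / ((N : ℝ) * T))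
      have e1 : ∀ c, lam / b * (b * c) = lam * c := fun c => by field_simp
      have e2 : ∀ c, 2 * (lam / b) * (b * c) = 2 * lam * c := fun c => by field_simp
      rw [e1, e2, e2] at h1
      have e3 : ∀ c, 2 * (lam / ((N : ℝ) * T)) * c = 1 / ((N : ℝ) * T) * (2 * lam * c) :=
        fun c => by ring
      have e4 : ∀ c, lam / ((N : ℝ) * T) * c = 1 / ((N : ℝ) * T) * (lam * c) :=
        fun c => by ring
      rw [e3, e3, e4]
      linarith)
    (fun j hj => by simpa [hJ₁] using hj)
    (by
      have : ∑ i ∈ J₂ᶜ, |w i| = 1 / b * ∑ i ∈ J₂ᶜ, |P.η i| := by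
        simp only [hw, abs_div, abs_of_pos hb0, Finset.mul_sum]
        exact Finset.sum_congr rfl fun i _ => by ring
      rw [this, mul_assoc]
      gcongr)
    (by
      have : (J₁.card : ℝ) ≤ s := by exact_mod_cast hJ₁s
      have h0 : 0 < E * x ^ (-ν) := by positivity
      linarith)
    (by
      have : (0 : ℝ) ≤ s := by positivity
      linarith)
    (fun hc => by
      have h1 := restrictedEigenvalueSq_le_quadratic hκ₀ hA hJ₁s hc
      rw [hpe, hsq]
      linarith [hgr.1, hcr.1])
    (by
      rw [hpe, hsq]
      linarith [hcr.1])
    hτ hsmall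
  have hxl : x = b * l := by
    rw [hx, hl, ← hb2]; field_simp
  -- The threshold `x = √N l` balances the two costs of weak sparsity: estimating the large effects
  -- costs as much as ignoring the small ones.
  have hkey : E * x ^ (-ν) * l = 1 / b * E * x ^ (1 - ν) := by
    rw [show (1 - ν) = -ν + 1 by ring, Real.rpow_add hx0, Real.rpow_one]
    nth_rewrite 3 [hxl]
    field_simp
  have hSl : (s + E * x ^ (-ν)) * l + 1 / b * E * x ^ (1 - ν)
      = s * l + 2 * (1 / b * E * x ^ (1 - ν)) := by rw [add_mul, hkey]; ring
  rw [hSl] at hc1 hc2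
  have hs0 : (0 : ℝ) ≤ s := by positivity
  have hsl : 0 ≤ s * l := by positivity
  have hk : 0 < 3200 / κ₀ := by positivity
  have hfin : 3200 / κ₀ * (s * l + 2 * (1 / b * E * x ^ (1 - ν)))
      ≤ 3200 / κ₀ * (s * l + 1 / b * E * x ^ (1 - ν)) * 2 := by
    rw [mul_assoc (3200 / κ₀) _ 2]
    refine mul_le_mul_of_nonneg_left ?_ hk.le
    have : 0 < 1 / b * E * x ^ (1 - ν) := by positivity
    linarith
  refine ⟨?_, ?_, ?_⟩
  · have h1 : l * (s * l + 2 * (1 / b * E * x ^ (1 - ν)))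
        ≤ (s * l ^ 2 + lam / (b * ((N : ℝ) * T)) * E * x ^ (1 - ν)) * 2 := by
      have e1 : lam / (b * ((N : ℝ) * T)) * E * x ^ (1 - ν) = l * (1 / b * E * x ^ (1 - ν)) := by
        rw [hl]; field_simp
      have : 0 ≤ s * l ^ 2 := by positivity
      rw [e1]; linarith
    rw [mul_assoc (3200 / κ₀) _ 2]
    exact hc1.trans (by gcongr)
  · have e : ∑ j, |a j - P.α j| = ∑ j, |u j| := rfl
    rw [e]
    linarith
  · have e : ∑ i, |h i - P.η i| = b * ∑ i, |v i| := by
      rw [← hΔ]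
      exact Finset.sum_congr rfl fun i _ => congrArg _ (congrFun hhv i).symm
    have e1 : s * (lam / (b * T)) + E * x ^ (1 - ν) = b * (s * l + 1 / b * E * x ^ (1 - ν)) := by
      rw [hl, ← hb2]; field_simp
    have h2 : ∑ i, |v i| ≤ 3200 / κ₀ * (s * l + 1 / b * E * x ^ (1 - ν)) * 2 := by linarith
    rw [e, e1]
    calc b * ∑ i, |v i| ≤ b * (3200 / κ₀ * (s * l + 1 / b * E * x ^ (1 - ν)) * 2) := by gcongr
      _ = _ := by ring

end DynamicPanel

/-! ### Measurability, orthogonality of the noise, and tail bounds for sums. -/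

lemma integral_mul_eq_zero_of_condExp {Ω : Type*} {m mΩ : MeasurableSpace Ω} (hm : m ≤ mΩ)
    {μ : Measure Ω} [IsProbabilityMeasure μ] {f g : Ω → ℝ} (hf : Measurable[m] f)
    (hfm : HasAllMoments f μ) (hgm : HasAllMoments g μ) (hg : μ[g | m] =ᵐ[μ] 0) :
    ∫ ω, f ω * g ω ∂μ = 0 := by
  have h1 := condExp_mul_of_stronglyMeasurable_left hf.stronglyMeasurable
    (hfm.mul hgm).integrable hgm.integrable
  calc ∫ ω, f ω * g ω ∂μ = ∫ ω, (μ[f * g | m]) ω ∂μ := (integral_condExp hm).symm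
    _ = ∫ _, (0 : ℝ) ∂μ := by
        refine integral_congr_ae ?_
        filter_upwards [h1, hg] with ω h2 h3
        rw [h2, Pi.mul_apply, h3, Pi.zero_apply, mul_zero]
    _ = 0 := integral_zero _ _

namespace DynamicPanel

variable {Ω : Type*} [mΩ : MeasurableSpace Ω] {N T L q : ℕ}

/-- The initial observations, covariates and errors of individual `i`. -/
def individualData (P : DynamicPanel Ω N T L q) (i : Fin N) (ω : Ω) :
    (Fin L → ℝ) × (Fin T → Fin q → ℝ) × (Fin T → ℝ) :=
  (fun l => P.y i (-(l : ℤ)) ω, fun t k => P.x i t k ω, fun t => P.ε i t ω)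

/-- The `σ`-algebra generated by the data of individual `i`. -/
@[reducible] def individual (P : DynamicPanel Ω N T L q) (i : Fin N) : MeasurableSpace Ω :=
  MeasurableSpace.comap (P.individualData i) inferInstance

lemma individual_le (P : DynamicPanel Ω N T L q) (i : Fin N) : P.individual i ≤ mΩ := by
  refine Measurable.comap_le ?_
  refine Measurable.prodMk ?_ (Measurable.prodMk ?_ ?_)
  · exact measurable_pi_lambda _ fun l => P.measurable_y i _
  · exact measurable_pi_lambda _ fun t => measurable_pi_lambda _ fun k => P.measurable_x i t k
  · exact measurable_pi_lambda _ fun t => P.measurable_ε i t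

lemma individual_measurable_initial (P : DynamicPanel Ω N T L q) (i : Fin N) (l : Fin L) :
    Measurable[P.individual i] (P.y i (-(l : ℤ))) :=
  (by fun_prop : Measurable fun d : (Fin L → ℝ) × (Fin T → Fin q → ℝ) × (Fin T → ℝ) =>
    d.1 l).comp (comap_measurable (P.individualData i))

lemma individual_measurable_x (P : DynamicPanel Ω N T L q) (i : Fin N) (t : Fin T) (k : Fin q) :
    Measurable[P.individual i] (P.x i t k) :=
  (by fun_prop : Measurable fun d : (Fin L → ℝ) × (Fin T → Fin q → ℝ) × (Fin T → ℝ) =>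
    d.2.1 t k).comp (comap_measurable (P.individualData i))

lemma individual_measurable_ε (P : DynamicPanel Ω N T L q) (i : Fin N) (t : Fin T) :
    Measurable[P.individual i] (P.ε i t) :=
  (by fun_prop : Measurable fun d : (Fin L → ℝ) × (Fin T → Fin q → ℝ) × (Fin T → ℝ) =>
    d.2.2 t).comp (comap_measurable (P.individualData i))

/-- The model equation is solved recursively from the initial observations. The shift `n ↦ n + 1 -
L` starts the induction at the earliest of them; `n < L` indexes exactly the initial ones. -/
lemma individual_measurable_y (P : DynamicPanel Ω N T L q) (i : Fin N) (n : ℕ) (hn : n < T + L) :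
    Measurable[P.individual i] (P.y i ((n : ℤ) + 1 - L)) := by
  induction n using Nat.strong_induction_on with
  | _ n ih =>
    rcases lt_or_ge n L with h | h
    · have := P.individual_measurable_initial i ⟨L - 1 - n, by omega⟩
      convert! this using 2
      simp only
      omega
    · have ht : n - L < T := by omega
      have e : P.y i ((n : ℤ) + 1 - L) = fun ω =>
          (∑ l : Fin L, P.α (Sum.inl l) * P.y i (((n - 1 - l : ℕ) : ℤ) + 1 - L) ω)
            + (∑ k : Fin q, P.x i ⟨n - L, ht⟩ k ω * P.α (Sum.inr k)) + P.η i
            + P.ε i ⟨n - L, ht⟩ ω := by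
        funext ω
        have h1 := P.model_eq i ⟨n - L, ht⟩ ω
        simp only at h1
        rw [show ((n : ℤ) + 1 - L) = ((n - L : ℕ) : ℤ) + 1 by omega, h1]
        congr 3
        refine Finset.sum_congr rfl fun l _ => ?_
        have := l.2
        rw [show ((n - L : ℕ) : ℤ) + 1 - ((l : ℤ) + 1) = ((n - 1 - l : ℕ) : ℤ) + 1 - L by omega]
      rw [e]
      refine ((Measurable.add ?_ ?_).add measurable_const).add (P.individual_measurable_ε i _)
      · refine Finset.measurable_fun_sum _ fun l _ => ?_
        have := l.2
        exact (ih (n - 1 - l) (by omega) (by omega)).const_mul _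
      · exact Finset.measurable_fun_sum _ fun k _ => (P.individual_measurable_x i _ k).mul_const _

lemma individual_measurable_z (P : DynamicPanel Ω N T L q) (i : Fin N) (t : Fin T)
    (j : Fin L ⊕ Fin q) : Measurable[P.individual i] (P.z i t j) := by
  rcases j with l | k
  · have hl := l.2
    have ht := t.2
    have := P.individual_measurable_y i (t + (L - 1 - l)) (by omega)
    rw [show (((t : ℕ) + (L - 1 - l) : ℕ) : ℤ) + 1 - L = (t : ℤ) + 1 - ((l : ℤ) + 1) by omega]
      at this
    exact this
  · exact P.individual_measurable_x i t k

lemma past_le (P : DynamicPanel Ω N T L q) (i : Fin N) (t : Fin T) : P.past i t ≤ mΩ :=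
  sup_le (iSup₂_le fun τ _ => (P.measurable_y i τ).comap_le)
    (iSup₂_le fun s _ => iSup_le fun k => (P.measurable_x i s k).comap_le)

lemma past_measurable_y (P : DynamicPanel Ω N T L q) (i : Fin N) (t : Fin T) {τ : ℤ}
    (h1 : 1 - (L : ℤ) ≤ τ) (h2 : τ ≤ t) : Measurable[P.past i t] (P.y i τ) :=
  Measurable.mono (comap_measurable (P.y i τ)) (le_sup_of_le_left
    (le_iSup₂_of_le (f := fun τ (_ : τ ∈ Set.Icc (1 - (L : ℤ)) (t : ℤ)) =>
      MeasurableSpace.comap (P.y i τ) inferInstance) τ ⟨h1, h2⟩ le_rfl)) le_rfl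

lemma past_measurable_x (P : DynamicPanel Ω N T L q) (i : Fin N) {s t : Fin T} (hs : s ≤ t)
    (k : Fin q) : Measurable[P.past i t] (P.x i s k) :=
  Measurable.mono (comap_measurable (P.x i s k)) (le_sup_of_le_right
    (le_iSup₂_of_le (f := fun s (_ : s ∈ Set.Iic t) =>
      ⨆ k : Fin q, MeasurableSpace.comap (P.x i s k) inferInstance) s hs
      (le_iSup (fun k : Fin q => MeasurableSpace.comap (P.x i s k) inferInstance) k))) le_rfl

lemma past_measurable_z (P : DynamicPanel Ω N T L q) (i : Fin N) {s t : Fin T} (hs : s ≤ t)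
    (j : Fin L ⊕ Fin q) : Measurable[P.past i t] (P.z i s j) := by
  have hs' : (s : ℕ) ≤ t := hs
  rcases j with l | k
  · have hl := l.2
    exact P.past_measurable_y i t (by omega) (by omega)
  · exact P.past_measurable_x i hs k

/-- Past errors are recovered from the model equation. Index `s` stands for period `s + 1`, and `s <
t` puts `y` at that period inside the past of `t`, which ends at calendar time `t`. -/
lemma past_measurable_ε (P : DynamicPanel Ω N T L q) (i : Fin N) {s t : Fin T} (hs : s < t) :
    Measurable[P.past i t] (P.ε i s) := by
  have hs' : (s : ℕ) < t := hs
  have e : P.ε i s = fun ω => P.y i ((s : ℤ) + 1) ω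
      - (∑ j, P.z i s j ω * P.α j + P.η i) := by
    funext ω
    have := P.y_eq_design_add_error ω (i, s)
    rw [design_mulVec] at this
    simp only at this
    rw [this]; ring
  rw [e]
  refine (P.past_measurable_y i t (by omega) (by omega)).sub (Measurable.add ?_ measurable_const)
  exact Finset.measurable_fun_sum _ fun j _ => (P.past_measurable_z i hs.le j).mul_const _

lemma measurable_z (P : DynamicPanel Ω N T L q) (i : Fin N) (t : Fin T)
    (j : Fin L ⊕ Fin q) : Measurable (P.z i t j) :=
  (P.individual_measurable_z i t j).mono (P.individual_le i) le_rfl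

variable {μ : Measure Ω} [IsProbabilityMeasure μ]

omit [IsProbabilityMeasure μ] in
lemma IndependentPredetermined.indepFun {P : DynamicPanel Ω N T L q}
    (hP : P.IndependentPredetermined μ) {i : Fin N} {A B : Ω → ℝ}
    (hA : Measurable[⨆ i' ∈ ({i}ᶜ : Set (Fin N)), P.individual i'] A)
    (hB : Measurable[P.individual i] B) : IndepFun A B μ := by
  have h1 := indep_iSup_of_disjoint (m := fun i => P.individual i) P.individual_le
    hP.indep.iIndep (disjoint_compl_left : Disjoint ({i}ᶜ : Set (Fin N)) {i})
  rw [IndepFun_iff_Indep]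
  refine indep_of_indep_of_le h1 hA.comap_le (hB.comap_le.trans ?_)
  exact le_iSup₂_of_le (f := fun i' (_ : i' ∈ ({i} : Set (Fin N))) => P.individual i') i rfl le_rfl

lemma measurable_of_ne {P : DynamicPanel Ω N T L q} {i i' : Fin N} (h : i' ≠ i) {A : Ω → ℝ}
    (hA : Measurable[P.individual i'] A) :
    Measurable[⨆ i' ∈ ({i}ᶜ : Set (Fin N)), P.individual i'] A :=
  hA.mono (le_iSup₂_of_le (f := fun i' (_ : i' ∈ ({i}ᶜ : Set (Fin N))) => P.individual i') i' h
    le_rfl) le_rfl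

/-- Along the lexicographic order, `ζ_{i,t} ε_{i,t}` is orthogonal to powers of earlier sums. -/
lemma IndependentPredetermined.integral_sum_pow_mul_eq_zero {P : DynamicPanel Ω N T L q}
    (hP : P.IndependentPredetermined μ) {ζ : Fin N → Fin T → Ω → ℝ}
    (hζ : ∀ i t s, s ≤ t → Measurable[P.past i t] (ζ i s))
    (hζi : ∀ i t, Measurable[P.individual i] (ζ i t))
    (hζm : ∀ i t, HasAllMoments (ζ i t) μ) (hεm : ∀ i t, HasAllMoments (P.ε i t) μ) (n : ℕ)
    (r : Fin N ×ₗ Fin T) (s : Finset (Fin N ×ₗ Fin T)) (hs : ∀ r' ∈ s, r' < r) :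
    ∫ ω, (∑ r' ∈ s, ζ (ofLex r').1 (ofLex r').2 ω * P.ε (ofLex r').1 (ofLex r').2 ω) ^ n
      * (ζ (ofLex r).1 (ofLex r).2 ω * P.ε (ofLex r).1 (ofLex r).2 ω) ∂μ = 0 := by
  obtain ⟨⟨i, t⟩, rfl⟩ := toLex.surjective r
  simp only [ofLex_toLex]
  set X : Fin N ×ₗ Fin T → Ω → ℝ := fun r' ω =>
    ζ (ofLex r').1 (ofLex r').2 ω * P.ε (ofLex r').1 (ofLex r').2 ω with hX
  have hXm : ∀ r', HasAllMoments (X r') μ := fun r' => (hζm _ _).mul (hεm _ _)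
  have hXi : ∀ r', Measurable[P.individual (ofLex r').1] (X r') := fun r' =>
    (hζi _ _).mul (P.individual_measurable_ε _ _)
  -- The conditional mean is zero given the past of individual `i` only, so the earlier sum is
  -- split: `A` collects other individuals and factors out by independence, while `B` collects
  -- earlier periods of `i` and is measurable with respect to its past.
  set A : Ω → ℝ := fun ω => ∑ r' ∈ s.filter fun r' => ¬ (ofLex r').1 = i, X r' ω with hA
  set B : Ω → ℝ := fun ω => ∑ r' ∈ s.filter fun r' => (ofLex r').1 = i, X r' ω with hB
  have hAm : HasAllMoments A μ := HasAllMoments.sum _ fun r' _ => hXm r'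
  have hBm : HasAllMoments B μ := HasAllMoments.sum _ fun r' _ => hXm r'
  have hAmeas : Measurable[⨆ i' ∈ ({i}ᶜ : Set (Fin N)), P.individual i'] A :=
    Finset.measurable_fun_sum _ fun r' hr' =>
      measurable_of_ne (Finset.mem_filter.1 hr').2 (hXi r')
  have hBi : Measurable[P.individual i] B :=
    Finset.measurable_fun_sum _ fun r' hr' => by
      have := hXi r'
      rwa [(Finset.mem_filter.1 hr').2] at this
  have hBp : Measurable[P.past i t] B :=
    Finset.measurable_fun_sum _ fun r' hr' => by
      obtain ⟨h1, h2⟩ := Finset.mem_filter.1 hr'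
      have hlt := hs r' h1
      obtain ⟨⟨i', t'⟩, rfl⟩ := toLex.surjective r'
      rw [Prod.Lex.toLex_lt_toLex] at hlt
      simp only [ofLex_toLex] at h2 hlt
      subst h2
      have hlt' : t' < t := by
        rcases hlt with h | h
        · exact absurd h (lt_irrefl _)
        · exact h.2
      exact (hζ _ _ _ hlt'.le).mul (P.past_measurable_ε _ hlt')
  have hsum : ∀ ω, ∑ r' ∈ s, X r' ω = A ω + B ω := fun ω => by
    rw [add_comm, hA, hB, Finset.sum_filter_add_sum_filter_not]
  have hterm : ∀ k l : ℕ, ∫ ω, A ω ^ k * (B ω ^ l * (ζ i t ω * P.ε i t ω)) ∂μ = 0 := by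
    intro k l
    have hind : IndepFun (fun ω => A ω ^ k) (fun ω => B ω ^ l * (ζ i t ω * P.ε i t ω)) μ :=
      hP.indepFun (hAmeas.pow_const k)
        ((hBi.pow_const l).mul ((hζi i t).mul (P.individual_measurable_ε i t)))
    rw [hind.integral_fun_mul_eq_mul_integral (hAm.pow k).aesm
      ((hBm.pow l).mul ((hζm i t).mul (hεm i t))).aesm]
    have h0 : ∫ ω, (B ω ^ l * ζ i t ω) * P.ε i t ω ∂μ = 0 :=
      integral_mul_eq_zero_of_condExp (P.past_le i t) ((hBp.pow_const l).mul (hζ i t t le_rfl))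
        ((hBm.pow l).mul (hζm i t)) (hεm i t) (hP.condExp_eq_zero i t)
    simp only [mul_assoc] at h0
    rw [h0, mul_zero]
  have hexp : ∀ ω, (∑ r' ∈ s, X r' ω) ^ n * (ζ i t ω * P.ε i t ω)
      = ∑ k ∈ Finset.range (n + 1), (n.choose k : ℝ)
        * (A ω ^ k * (B ω ^ (n - k) * (ζ i t ω * P.ε i t ω))) := fun ω => by
    rw [hsum, add_pow, Finset.sum_mul]
    exact Finset.sum_congr rfl fun k _ => by ring
  refine (integral_congr_ae (ae_of_all _ hexp)).trans ?_
  rw [integral_finsetSum _ fun k _ =>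
    (((hAm.pow k).mul ((hBm.pow (n - k)).mul ((hζm i t).mul (hεm i t)))).const_mul _).integrable]
  simp only [integral_const_mul, hterm, mul_zero, Finset.sum_const_zero]

/-- Tail bound for sums of `ζ_{i,t} ε_{i,t}` over any set of observations. -/
lemma IndependentPredetermined.measure_sum_mul_error_sq_gt_le {P : DynamicPanel Ω N T L q}
    (hP : P.IndependentPredetermined μ) {ζ : Fin N → Fin T → Ω → ℝ}
    (hζ : ∀ i t s, s ≤ t → Measurable[P.past i t] (ζ i s))
    (hζi : ∀ i t, Measurable[P.individual i] (ζ i t))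
    (hζm : ∀ i t, HasAllMoments (ζ i t) μ) (hεm : ∀ i t, HasAllMoments (P.ε i t) μ)
    {m : ℕ} (hm : 1 ≤ m) {b : ℝ} (hb : 0 < b)
    (hζb : ∀ i t, ∫ ω, ζ i t ω ^ (2 * (2 * m)) ∂μ ≤ b ^ (2 * m))
    (hεb : ∀ i t, ∫ ω, P.ε i t ω ^ (2 * (2 * m)) ∂μ ≤ b ^ (2 * m))
    (s : Finset (Fin N × Fin T)) (hs : s.Nonempty) :
    μ.real {ω | 9 * (16 * m * s.card * b ^ 2)
      < (∑ r ∈ s, ζ r.1 r.2 ω * P.ε r.1 r.2 ω) ^ 2} ≤ Real.exp (-(2 * m)) := by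
  have hcard : (0 : ℝ) < s.card := by exact_mod_cast hs.card_pos
  have hm0 : (0 : ℝ) < m := by exact_mod_cast hm
  refine measure_sq_gt_le (HasAllMoments.sum _ fun r _ => (hζm _ _).mul (hεm _ _))
    (by positivity) ?_
  have := integral_sum_pow_le (μ := μ) (ι := Fin N ×ₗ Fin T)
    (X := fun r ω => ζ (ofLex r).1 (ofLex r).2 ω * P.ε (ofLex r).1 (ofLex r).2 ω)
    (fun r => (hζm _ _).mul (hεm _ _)) hm hb
    (fun r => integral_mul_pow_le (hζm _ _) (hεm _ _) (hζb _ _) (hεb _ _))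
    (fun r s hs => hP.integral_sum_pow_mul_eq_zero hζ hζi hζm hεm _ r s hs)
    (s.map toLex.toEmbedding)
  simpa only [Finset.sum_map, Finset.card_map, Equiv.coe_toEmbedding, ofLex_toLex] using this

/-- Tail bound for sums over individuals of centred functions of the data of one individual. -/
lemma IndependentPredetermined.measure_sum_centred_sq_gt_le {P : DynamicPanel Ω N T L q}
    (hP : P.IndependentPredetermined μ) {W : Fin N → Ω → ℝ}
    (hWi : ∀ i, Measurable[P.individual i] (W i)) (hWm : ∀ i, HasAllMoments (W i) μ)
    {m : ℕ} (hm : 1 ≤ m) (hN : 1 ≤ N) {b : ℝ} (hb : 0 < b)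
    (hWb : ∀ i, ∫ ω, W i ω ^ (2 * m) ∂μ ≤ b ^ (2 * m)) :
    μ.real {ω | 9 * (16 * m * N * (2 * b) ^ 2) < (∑ i, (W i ω - ∫ ω', W i ω' ∂μ)) ^ 2}
      ≤ Real.exp (-(2 * m)) := by
  have hN0 : (0 : ℝ) < N := by exact_mod_cast hN
  have hm0 : (0 : ℝ) < m := by exact_mod_cast hm
  have hXm : ∀ i, HasAllMoments (fun ω => W i ω - ∫ ω', W i ω' ∂μ) μ := fun i => by
    simpa only [sub_eq_add_neg] using (hWm i).add (HasAllMoments.const (-∫ ω', W i ω' ∂μ))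
  have hXi : ∀ i, Measurable[P.individual i] (fun ω => W i ω - ∫ ω', W i ω' ∂μ) := fun i =>
    (hWi i).sub_const _
  refine measure_sq_gt_le (HasAllMoments.sum _ fun i _ => hXm i) (by positivity) ?_
  have := integral_sum_pow_le (μ := μ) hXm hm (by positivity : 0 < 2 * b)
    (fun i => integral_sub_integral_pow_le (hWm i) (hWb i))
    (fun i s hs => by
      have hind := hP.indepFun (i := i)
        (A := fun ω => (∑ i' ∈ s, (W i' ω - ∫ ω', W i' ω' ∂μ)) ^ (2 * m - 1))
        (Measurable.pow_const (Finset.measurable_fun_sum _ fun i' hi' =>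
          measurable_of_ne (hs i' hi').ne (hXi i')) _) (hXi i)
      rw [hind.integral_fun_mul_eq_mul_integral
        ((HasAllMoments.sum _ fun i _ => hXm i).pow _).aesm (hXm i).aesm,
        integral_sub (hWm i).integrable (integrable_const _)]
      simp) Finset.univ
  simpa using this

end DynamicPanel

/-! ### The high-probability event. -/

lemma measureReal_iUnion_le_card_mul {Ω κ : Type*} [MeasurableSpace Ω] {μ : Measure Ω}
    [Fintype κ] {S : κ → Set Ω} {x : ℝ} (h : ∀ k, μ.real (S k) ≤ x) :
    μ.real (⋃ k, S k) ≤ Fintype.card κ * x := by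
  refine (measureReal_iUnion_fintype_le S).trans ?_
  refine (Finset.sum_le_sum fun k _ => h k).trans_eq ?_
  simp

namespace DynamicPanel

variable {Ω : Type*} [mΩ : MeasurableSpace Ω] {N T L q : ℕ} {μ : Measure Ω}
  [IsProbabilityMeasure μ]

omit [IsProbabilityMeasure μ] in
lemma sample_gram_sub_population_gram (P : DynamicPanel Ω N T L q)
    (hzm : ∀ i t j, HasAllMoments (P.z i t j) μ) (j k : Fin L ⊕ Fin q) (ω : Ω) :
    1 / ((N : ℝ) * T) * ∑ i, ∑ t, P.z i t j ω * P.z i t k ω - P.populationGram μ j k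
      = 1 / (N : ℝ) * ∑ i, ((1 / (T : ℝ) * ∑ t, P.z i t j ω * P.z i t k ω)
        - ∫ ω', 1 / (T : ℝ) * ∑ t, P.z i t j ω' * P.z i t k ω' ∂μ) := by
  have e : ∀ i, ∫ ω', 1 / (T : ℝ) * ∑ t, P.z i t j ω' * P.z i t k ω' ∂μ
      = 1 / (T : ℝ) * ∑ t, ∫ ω', P.z i t j ω' * P.z i t k ω' ∂μ := fun i => by
    rw [integral_const_mul, integral_finsetSum _ fun t _ =>
      ((hzm i t j).mul (hzm i t k)).integrable]
  simp only [e, populationGram, Matrix.of_apply, Finset.sum_sub_distrib, ← Finset.mul_sum]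
  field_simp

/-- With high probability the penalty dominates the noise and the scaled Gram matrix is close to
its population counterpart. -/
lemma measure_noise_or_gram_large_le {P : DynamicPanel Ω N T L q}
    (hP : P.IndependentPredetermined μ) {C K : ℝ} (hC : 0 < C) (hK : 0 < K)
    (hsub : P.UniformlySubgaussian μ C K) (hN : 1 ≤ N) (hT : 1 ≤ T) {m : ℕ} (hm : 1 ≤ m)
    {b : ℝ} (hb : b = (1 + (2 + K) / C) * (2 * m)) :
    ∃ bad : Set Ω,
      μ.real bad ≤ ((L + q : ℕ) + N + (L + q : ℕ) * (L + q : ℕ) + N * (L + q : ℕ))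
        * Real.exp (-(2 * m)) ∧
      ∀ ω ∉ bad,
        (∀ j, (∑ r : Fin N × Fin T, P.z r.1 r.2 j ω * P.ε r.1 r.2 ω) ^ 2
          ≤ 144 * m * (N * T) * b ^ 2) ∧
        (∀ i, (∑ t, P.ε i t ω) ^ 2 ≤ 144 * m * T * b ^ 2) ∧
        (∀ j k, (1 / ((N : ℝ) * T) * ∑ i, ∑ t, P.z i t j ω * P.z i t k ω
          - P.populationGram μ j k) ^ 2 ≤ 576 * m * b ^ 2 / N) ∧
        (∀ i j, (1 / Real.sqrt N * (1 / (T : ℝ) * ∑ t, P.z i t j ω)) ^ 2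
          ≤ 576 * m * b ^ 2 / N) := by
  have hN0 : (0 : ℝ) < N := by exact_mod_cast hN
  have hT0 : (0 : ℝ) < T := by exact_mod_cast hT
  have hm0 : (1 : ℝ) ≤ m := by exact_mod_cast hm
  have hc0 : 0 < (2 + K) / C := by positivity
  have hb1 : 1 ≤ b := by
    rw [hb]; nlinarith
  have hb0 : 0 < b := by linarith
  have hz := fun i t j => moments_of_subgaussian_tail (P.measurable_z i t j) hC hK
    (hsub.regressor_tail i t j)
  have hε := fun i t => moments_of_subgaussian_tail (P.measurable_ε i t) hC hK
    (hsub.error_tail i t)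
  -- Moments of order `4m`, since products such as `z ε` need moments of order `2m`.
  have hzb : ∀ i t j, ∫ ω, P.z i t j ω ^ (2 * (2 * m)) ∂μ ≤ b ^ (2 * m) := fun i t j => by
    have := (hz i t j).2 (2 * m) (by omega)
    rw [hb]; exact_mod_cast this
  have hεb : ∀ i t, ∫ ω, P.ε i t ω ^ (2 * (2 * m)) ∂μ ≤ b ^ (2 * m) := fun i t => by
    have := (hε i t).2 (2 * m) (by omega)
    rw [hb]; exact_mod_cast this
  have h1b : ∫ _ : Ω, (1 : ℝ) ^ (2 * (2 * m)) ∂μ ≤ b ^ (2 * m) := by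
    simpa using one_le_pow₀ hb1
  have hzm := fun i t j => (hz i t j).1
  have hεm := fun i t => (hε i t).1
  set W : Fin L ⊕ Fin q → Fin L ⊕ Fin q → Fin N → Ω → ℝ :=
    fun j k i ω => 1 / (T : ℝ) * ∑ t, P.z i t j ω * P.z i t k ω with hW
  have s1 : ∀ j, μ.real {ω | 9 * (16 * m * (N * T) * b ^ 2)
      < (∑ r : Fin N × Fin T, P.z r.1 r.2 j ω * P.ε r.1 r.2 ω) ^ 2} ≤ Real.exp (-(2 * m)) := by
    intro j
    have : Nonempty (Fin N × Fin T) := ⟨(⟨0, by omega⟩, ⟨0, by omega⟩)⟩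
    have := hP.measure_sum_mul_error_sq_gt_le (ζ := fun i t => P.z i t j)
      (fun i t s h => P.past_measurable_z i h j) (fun i t => P.individual_measurable_z i t j)
      (fun i t => hzm i t j) hεm hm hb0 (fun i t => hzb i t j) hεb Finset.univ
      Finset.univ_nonempty
    simpa using this
  have s2 : ∀ i, μ.real {ω | 9 * (16 * m * T * b ^ 2) < (∑ t, P.ε i t ω) ^ 2}
      ≤ Real.exp (-(2 * m)) := by
    intro i
    have : Nonempty (Fin T) := ⟨⟨0, by omega⟩⟩
    -- The dummy column is the case `ζ = 1`, for which `b ≥ 1` is needed.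
    have := hP.measure_sum_mul_error_sq_gt_le (ζ := fun _ _ _ => 1)
      (fun _ _ _ _ => measurable_const) (fun _ _ => measurable_const)
      (fun _ _ => HasAllMoments.const 1) hεm hm hb0 (fun _ _ => h1b) hεb
      ({i} ×ˢ Finset.univ) (by simp)
    simpa [Finset.sum_product] using this
  -- Only independence across individuals is used; time averages are handled by Jensen. Hence the
  -- Gram error is controlled at order `1/N` rather than `1/(NT)`, and centring doubles `b`.
  have s3 : ∀ jk : (Fin L ⊕ Fin q) × (Fin L ⊕ Fin q), μ.real {ω | 9 * (16 * m * N * (2 * b) ^ 2)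
      < (∑ i, (W jk.1 jk.2 i ω - ∫ ω', W jk.1 jk.2 i ω' ∂μ)) ^ 2} ≤ Real.exp (-(2 * m)) := by
    intro jk
    refine hP.measure_sum_centred_sq_gt_le (fun i => ?_) (fun i => ?_) hm hN hb0 fun i => ?_
    · exact (Finset.measurable_fun_sum _ fun t _ => (P.individual_measurable_z i t _).mul
        (P.individual_measurable_z i t _)).const_mul _
    · exact (HasAllMoments.sum _ fun t _ => (hzm i t _).mul (hzm i t _)).const_mul _
    · exact integral_mean_pow_le hT (fun t => (hzm i t _).mul (hzm i t _)) (even_two_mul m)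
        fun t => integral_mul_pow_le (hzm i t _) (hzm i t _) (hzb i t _) (hzb i t _)
  -- No concentration is needed here: a crude bound on each time average suffices because of the
  -- factor `1/√N` in the cross term.
  have s4 : ∀ ij : Fin N × (Fin L ⊕ Fin q), μ.real {ω | 9 * b ^ 2
      < (1 / (T : ℝ) * ∑ t, P.z ij.1 t ij.2 ω) ^ 2} ≤ Real.exp (-(2 * m)) := by
    intro ij
    refine measure_sq_gt_le ((HasAllMoments.sum _ fun t _ => hzm ij.1 t ij.2).const_mul _)
      (by positivity) ?_
    rw [← pow_mul]
    refine integral_mean_pow_le hT (fun t => hzm ij.1 t ij.2) (even_two_mul m) fun t => ?_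
    simpa using integral_mul_pow_le (hzm ij.1 t ij.2) (HasAllMoments.const (1 : ℝ))
      (hzb ij.1 t ij.2) h1b
  have u1 := measureReal_iUnion_le_card_mul s1
  have u2 := measureReal_iUnion_le_card_mul s2
  have u3 := measureReal_iUnion_le_card_mul s3
  have u4 := measureReal_iUnion_le_card_mul s4
  simp only [Fintype.card_prod, Fintype.card_sum, Fintype.card_fin] at u1 u2 u3 u4
  refine ⟨_, ((measureReal_union_le _ _).trans (add_le_add ((measureReal_union_le _ _).trans
    (add_le_add ((measureReal_union_le _ _).trans (add_le_add u1 u2)) u3)) u4)).trans_eq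
    (by push_cast; ring), fun ω hω => ?_⟩
  simp only [Set.mem_union, Set.mem_iUnion, Set.mem_ofPred_eq, not_or, not_exists, not_lt] at hω
  obtain ⟨⟨⟨g1, g2⟩, g3⟩, g4⟩ := hω
  refine ⟨fun j => (g1 j).trans_eq (by ring), fun i => (g2 i).trans_eq (by ring),
    fun j k => ?_, fun i j => ?_⟩
  · rw [sample_gram_sub_population_gram P hzm, mul_pow, le_div_iff₀ hN0]
    calc (1 / (N : ℝ)) ^ 2 * _ * N
        ≤ (1 / (N : ℝ)) ^ 2 * (9 * (16 * m * N * (2 * b) ^ 2)) * N := by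
          gcongr
          exact g3 (j, k)
      _ = _ := by field_simp; ring
  · rw [mul_pow, div_pow, Real.sq_sqrt hN0.le, one_pow, one_div_mul_eq_div]
    gcongr
    have h1 := g4 (i, j)
    have h2 : b ^ 2 ≤ m * b ^ 2 := le_mul_of_one_le_left (sq_nonneg b) hm0
    simp only at h1
    linarith [sq_nonneg b]

end DynamicPanel

/-! ### Choice of constants and conclusion. -/

/-- Stated for arbitrary sets: the estimators are not assumed measurable, so neither are the error
events. -/
lemma measureReal_le_of_ae_imp {Ω : Type*} [MeasurableSpace Ω] {μ : Measure Ω}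
    [IsProbabilityMeasure μ] {A bad : Set Ω} (h : ∀ᵐ ω ∂μ, ω ∉ bad → ω ∉ A) :
    μ.real A ≤ μ.real bad := by
  refine ENNReal.toReal_mono (measure_ne_top _ _) (measure_mono_ae ?_)
  filter_upwards [h] with ω hω hA
  exact by_contra fun hb => hω hb hA

theorem mainTheorem5 (C K : ℝ) (hC : 0 < C) (hK : 0 < K) :
    ∃ M₀ : ℝ, 0 < M₀ ∧ ∀ M : ℝ, M₀ ≤ M →
    ∀ (T L q s : ℕ → ℕ) (E : ℕ → ℝ) (ν κ₀ : ℝ),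
      (∀ N, 1 ≤ T N) → (∀ N, 1 ≤ s N ∧ s N ≤ L N + q N) → (∀ N, 0 < E N) →
      0 < ν → ν < 1 → 0 < κ₀ →
      Tendsto (fun N : ℕ =>
        Real.log (max (L N + q N) N : ℕ) ^ 3
          * ((s N : ℝ) + E N * thresholdLevel M N (T N) (L N + q N) ^ (-ν)) ^ 2 / (N : ℝ))
        atTop (𝓝 0) →
      -- stochastic orders, uniformly over all models with parameters in the class
      ∀ δ : ℝ, 0 < δ → ∃ B : ℝ, 0 < B ∧ ∃ N₀ : ℕ, ∀ N : ℕ, N₀ ≤ N →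
        ∀ (Ω : Type*) [MeasurableSpace Ω] (μ : Measure Ω) [IsProbabilityMeasure μ]
          (P : DynamicPanel Ω N (T N) (L N) (q N))
          (αhat : Ω → Fin (L N) ⊕ Fin (q N) → ℝ) (ηhat : Ω → Fin N → ℝ),
          P.IndependentPredetermined μ →
          κ₀ ≤ restrictedEigenvalueSq (P.populationGram μ) (s N) →
          P.UniformlySubgaussian μ C K →
          (P.α, P.η) ∈ sparseClass (s N) ν (E N) →
          P.IsPanelLasso μ (penaltyLevel M N (T N) (L N + q N)) αhat ηhat →
          let lam := penaltyLevel M N (T N) (L N + q N)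
          let Ξ := thresholdLevel M N (T N) (L N + q N)
          μ.real {ω | B * ((s N : ℝ) * (lam / ((N : ℝ) * T N)) ^ 2
                + lam / (Real.sqrt N * ((N : ℝ) * T N)) * E N * Ξ ^ (1 - ν))
              < P.predictionError ω (αhat ω) (ηhat ω)} ≤ δ ∧
          μ.real {ω | B * ((s N : ℝ) * (lam / ((N : ℝ) * T N))
                + 1 / Real.sqrt N * E N * Ξ ^ (1 - ν))
              < ∑ j, |αhat ω j - P.α j|} ≤ δ ∧
          μ.real {ω | B * ((s N : ℝ) * (lam / (Real.sqrt N * T N)) + E N * Ξ ^ (1 - ν))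
              < ∑ i, |ηhat ω i - P.η i|} ≤ δ := by
  set c := 1 + (2 + K) / C with hc
  have hc0 : 0 < c := by positivity
  -- With `m ≤ 3 log p`, the squared noise bound `144 m (2cm)²` is at most `576 · 27 c² log³ p =
  -- 15552 c² log³ p`; this must not exceed `M log³ p`.
  refine ⟨15552 * c ^ 2, by positivity, fun M hM T L q s E ν κ₀ hT hs hE hν hν1 hκ₀ hlim δ hδ => ?_⟩
  have hM0 : 0 < M := lt_of_lt_of_le (by positivity) hM
  -- Since `τ² ≤ 2304 · 27 c² log³ p / N = 62208 c² log³ p / N`, this is the level at which the rate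
  -- hypothesis yields `9600 S τ ≤ κ₀`.
  set ρ := κ₀ ^ 2 / (9600 ^ 2 * (62208 * c ^ 2)) with hρ
  have hρ0 : 0 < ρ := by positivity
  obtain ⟨N₁, hN₁⟩ := eventually_atTop.1 (hlim.eventually_lt_const hρ0)
  -- `B` does not depend on `δ`; only `N₀` does. `N ≥ 3` ensures `log p ≥ 1`, and `N ≥ 4/δ` handles
  -- the failure probability.
  refine ⟨3200 / κ₀ * 2, by positivity, max 3 (max N₁ ⌈4 / δ⌉₊), fun N hN => ?_⟩
  have hN3 : 3 ≤ N := (le_max_left _ _).trans hN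
  have hsmall := hN₁ N (((le_max_left _ _).trans (le_max_right _ _)).trans hN)
  have hNδ : 4 / δ ≤ N := Nat.ceil_le.1 (((le_max_right _ _).trans (le_max_right _ _)).trans hN)
  intro Ω _ μ _ P αhat ηhat hP hA hsub hclass hlasso lam Ξ
  have hN1 : 1 ≤ N := by omega
  have hN0 : (0 : ℝ) < N := by exact_mod_cast hN1
  have hT0 : (0 : ℝ) < T N := by exact_mod_cast hT N
  set p := max (L N + q N) N with hp
  have hNp : N ≤ p := le_max_right _ _
  have hpp : L N + q N ≤ p := le_max_left _ _
  have hp3 : (3 : ℝ) ≤ p := by exact_mod_cast hN3.trans hNp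
  have hp0 : (0 : ℝ) < p := by linarith
  set g := Real.log p with hg
  have hg1 : 1 ≤ g := by
    rw [hg, Real.le_log_iff_exp_le hp0]
    linarith [Real.exp_one_lt_d9]
  set m := ⌈2 * g⌉₊ with hm
  have hm2 : 2 * g ≤ m := Nat.le_ceil _
  have hm3 : (m : ℝ) ≤ 3 * g := by
    have := Nat.ceil_lt_add_one (by linarith : 0 ≤ 2 * g)
    linarith
  have hm1 : 1 ≤ m := Nat.one_le_iff_ne_zero.2 fun h0 => by
    rw [h0] at hm2; norm_num at hm2; linarith
  have hm0 : (0 : ℝ) < m := by exact_mod_cast hm1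
  have hm27 : (m : ℝ) ^ 3 ≤ 27 * g ^ 3 := by
    calc (m : ℝ) ^ 3 ≤ (3 * g) ^ 3 := by gcongr
      _ = _ := by ring
  obtain ⟨bad, hbad, hgood⟩ := DynamicPanel.measure_noise_or_gram_large_le hP hC hK hsub hN1 (hT N)
    hm1 rfl
  rw [← hc] at hgood
  have hbadδ : μ.real bad ≤ δ := by
    have hexp : Real.exp (-(2 * m)) ≤ ((p : ℝ) ^ 4)⁻¹ := by
      rw [Real.exp_neg]
      gcongr
      calc (p : ℝ) ^ 4 = Real.exp g ^ 4 := by rw [hg, Real.exp_log hp0]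
        _ = Real.exp (4 * g) := by rw [← Real.exp_nat_mul]; norm_num
        _ ≤ _ := Real.exp_le_exp.2 (by linarith)
    have hNp' : (N : ℝ) ≤ p := by exact_mod_cast hNp
    have hpp' : ((L N + q N : ℕ) : ℝ) ≤ p := by exact_mod_cast hpp
    have hcount : ((L N + q N : ℕ) : ℝ) + N + (L N + q N : ℕ) * (L N + q N : ℕ)
        + N * (L N + q N : ℕ) ≤ 4 * (p : ℝ) ^ 2 := by
      have h1 : ((L N + q N : ℕ) : ℝ) * (L N + q N : ℕ) ≤ p * p := by gcongr
      have h2 : (N : ℝ) * (L N + q N : ℕ) ≤ p * p := by gcongr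
      nlinarith
    calc μ.real bad ≤ 4 * (p : ℝ) ^ 2 * ((p : ℝ) ^ 4)⁻¹ := hbad.trans (by gcongr)
      _ = 4 / (p : ℝ) ^ 2 := by field_simp
      _ ≤ 4 / N := by
          gcongr
          nlinarith
      _ ≤ δ := by
          rw [div_le_iff₀ hδ] at hNδ
          rw [div_le_iff₀ hN0]; linarith
  have hlam2 : lam ^ 2 = 4 * M * N * T N * g ^ 3 := Real.sq_sqrt (by positivity)
  have hlam0 : 0 < lam := Real.sqrt_pos.2 (by
    rw [← hp, ← hg]; positivity)
  have hMg : 144 * m * (c * (2 * m)) ^ 2 ≤ M * g ^ 3 := by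
    calc 144 * m * (c * (2 * m)) ^ 2 = 576 * c ^ 2 * (m : ℝ) ^ 3 := by ring
      _ ≤ 576 * c ^ 2 * (27 * g ^ 3) := by gcongr
      _ = 15552 * c ^ 2 * g ^ 3 := by ring
      _ ≤ M * g ^ 3 := by gcongr
  set τ := Real.sqrt (576 * m * (c * (2 * m)) ^ 2 / N) with hτ
  have hτ0 : 0 ≤ τ := Real.sqrt_nonneg _
  have hτ2 : τ ^ 2 = 576 * m * (c * (2 * m)) ^ 2 / N := Real.sq_sqrt (by positivity)
  have hΞ0 : 0 < Ξ := by
    change 0 < lam / (Real.sqrt N * T N)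
    positivity
  have hsm : 9600 * (s N + E N * Ξ ^ (-ν)) * τ ≤ κ₀ := by
    refine le_of_sq_le_sq ?_ hκ₀.le
    have h1 : τ ^ 2 ≤ 62208 * c ^ 2 * (g ^ 3 / N) := by
      rw [hτ2, mul_div_assoc', div_le_div_iff_of_pos_right hN0]
      calc 576 * m * (c * (2 * m)) ^ 2 = 2304 * c ^ 2 * (m : ℝ) ^ 3 := by ring
        _ ≤ 2304 * c ^ 2 * (27 * g ^ 3) := by gcongr
        _ = _ := by ring
    have h2 : g ^ 3 * (s N + E N * Ξ ^ (-ν)) ^ 2 / N ≤ ρ := hsmall.le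
    calc (9600 * (s N + E N * Ξ ^ (-ν)) * τ) ^ 2
        = 9600 ^ 2 * (s N + E N * Ξ ^ (-ν)) ^ 2 * τ ^ 2 := by ring
      _ ≤ 9600 ^ 2 * (s N + E N * Ξ ^ (-ν)) ^ 2 * (62208 * c ^ 2 * (g ^ 3 / N)) := by gcongr
      _ = 9600 ^ 2 * (62208 * c ^ 2) * (g ^ 3 * (s N + E N * Ξ ^ (-ν)) ^ 2 / N) := by ring
      _ ≤ 9600 ^ 2 * (62208 * c ^ 2) * ρ := by gcongr
      _ = κ₀ ^ 2 := by rw [hρ]; field_simp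
  have hall : ∀ᵐ ω ∂μ, ω ∉ bad → _ := hlasso.mono fun ω hmin hω => by
    obtain ⟨g1, g2, g3, g4⟩ := hgood ω hω
    exact P.lasso_error_bounds hN1 (hT N) ω hlam0 hν hν1 hκ₀ (hE N) (x := Ξ) rfl hA hclass
      (hmin (P.α, P.η))
      (fun j => abs_le_of_sq_le_sq ((g1 j).trans (by
        rw [div_pow, hlam2]
        have := mul_le_mul_of_nonneg_left hMg (by positivity : 0 ≤ (N : ℝ) * T N)
        linarith)) (by positivity))
      (fun i => abs_le_of_sq_le_sq ((g2 i).trans (by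
        rw [div_pow, div_pow, hlam2, Real.sq_sqrt hN0.le]
        have := mul_le_mul_of_nonneg_left hMg (by positivity : 0 ≤ (T N : ℝ))
        have e : 4 * M * N * T N * g ^ 3 / N / 2 ^ 2 = T N * (M * g ^ 3) := by
          field_simp; ring
        rw [e]; linarith)) (by positivity))
      (fun j k => abs_le_of_sq_le_sq ((g3 j k).trans_eq hτ2.symm) hτ0)
      (fun i j => abs_le_of_sq_le_sq ((g4 i j).trans_eq hτ2.symm) hτ0) hτ0 hsm
  refine ⟨?_, ?_, ?_⟩ <;> refine (measureReal_le_of_ae_imp ?_).trans hbadδ <;>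
    filter_upwards [hall] with ω h hω <;> rw [not_lt, mul_right_comm]
  · exact (h hω).1
  · exact (h hω).2.1
  · exact (h hω).2.2
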